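/- **Conventions.** All spaces are real and $\mathbb Z$-graded. For a graded space $V$ and $a\in V$ homogeneous of degree $|a|$ put $\deg a=|a|-1$, the degree of $a$ in $V[1]$. All Koszul signs are taken with respect to $\deg$. For $p,q\ge 1$ let $bat_{p,q}(a_1\otimes\cdots\otimes a_p,\,a_{p+1}\otimes\cdots\otimes a_{p+q})$ be the sum, with Koszul signs, of all tensors in which the factors $a_1,\dots,a_p$ and the factors $a_{p+1},\dots,a_{p+q}$ appear each in their own order. Let $\underline{\otimes^nV[1]}$ be the quotient of $\otimes^nV[1]$ by the images of all $bat_{p,n-p}$, $0<p<n$, and let $\underline{a_1\otimes\cdots\otimes a_n}$ be the class of $a_1\otimes\cdots\otimes a_n$. On $\bigoplus_{n\ge1}\underline{\otimes^nV[1]}$ there is the Lie cobracket $$\delta(\underline{a_1\otimes\cdots\otimes a_n})=\sum_{0<j<n}\Big(\underline{a_1\otimes\cdots\otimes a_j}\otimes\underline{a_{j+1}\otimes\cdots\otimes a_n}-(-1)^{(\deg a_1+\cdots+\deg a_j)(\deg a_{j+1}+\cdots+\deg a_n)}\,\underline{a_{j+1}\otimes\cdots\otimes a_n}\otimes\underline{a_1\otimes\cdots\otimes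 a_j}\Big).$$ A morphism of Lie coalgebras is a linear map $F$ of degree $0$ with $(F\otimes F)\circ\delta=\delta\circ F$; $F_n$ denotes the restriction of $F$ to $\underline{\otimes^n(\cdot)}$ followed by the projection on the summand with one tensor factor. Let $R$ be a graded commutative associative algebra (not necessarily unital). Put $m(a\otimes b)=(-1)^{\deg a}ab$. Then $C_\infty(R)$ is the Lie coalgebra $\bigoplus_{n\ge1}\underline{\otimes^nR[1]}$ with $$m(\underline{a_0\otimes\cdots\otimes a_n})=\sum_{j=0}^{n-1}(-1)^{\sum_{i<j}\deg a_i}\,\underline{a_0\otimes\cdots\otimes m(a_j\otimes a_{j+1})\otimes\cdots\otimes a_n}.$$ A morphism of $C_\infty$ algebras is a morphism of Lie coalgebras that commutes with $m$. Let $M$ be a graded symmetric $R$-bimodule, i.e. $v.a=(-1)^{|a||v|}a.v$, and put $m(a\otimes v)=(-1)^{\deg a}a.v$ and $m(v\otimes a)=(-1)^{\deg v}v.a$. Let $S=R\ltimes M$ be $R\oplus M$ with the product $(a+u)(b+v)=ab+(ub+av)$, a graded commutative associative algebra, and let $\iota:R\to S$ be the inclusion. * The *Harrison homology complex* of $M$: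 its chains with $n$ factors are the quotient of $\bigoplus_{j+k=n-1}\otimes^jR[1]\otimes M[1]\otimes\otimes^kR[1]$ by the shuffles $bat_{p,n-p}$, $0<p<n$, of tensors that have altogether exactly one factor in $M[1]$. Its boundary $\partial$, which lowers the number of factors by one, is given by the same formula as $m$ above, with the products $m(a\otimes b)$, $m(a\otimes v)$, $m(v\otimes a)$. * The *Harrison cochains*: $C^n(R,M)=L(\underline{\otimes^nR[1]},M[1])$, $n\ge1$. For $f\in C^n(R,M)$ homogeneous of degree $\deg f$, the coboundary $\partial f\in C^{n+1}(R,M)$ is $$(\partial f)(\underline{a_0\otimes\cdots\otimes a_n})=(-1)^{\deg f\deg a_0}m\big(a_0\otimes f(\underline{a_1\otimes\cdots\otimes a_n})\big)+m\big(f(\underline{a_0\otimes\cdots\otimes a_{n-1}})\otimes a_n\big)-(-1)^{\deg f}\sum_{j=0}^{n-1}(-1)^{\sum_{k<j}\deg a_k}f(\underline{a_0\otimes\cdots\otimes m(a_j\otimes a_{j+1})\otimes\cdots\otimes a_n}).$$ **Proposition.** 1. The Harrison homology complex of $M$ is a subcomplex of $(C_\infty(S),m_S)$. That is, $m_S^2=0$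 and $\partial^2=0$, and the canonical map from the chains of $M$ to $C_\infty(S)$, which preserves the number of tensor factors, is injective and carries $\partial$ to $m_S$. 2. Let $F:\bigoplus_{n\ge1}\underline{\otimes^nR[1]}\to\bigoplus_{n\ge1}\underline{\otimes^nS[1]}$ be a morphism of Lie coalgebras of degree $0$ with $F_1=\iota+c_1$ and $F_n=c_n$ for $n\ge2$, where $c_n\in C^n(R,M)$. Then $F$ is a morphism of $C_\infty$ algebras, i.e. $m_S\circ F=F\circ m_R$, if and only if $\partial c_j=0$ for all $j\ge1$. 3. Such an $F$ is called trivial if there is a sequence $b=(b_n)_{n\ge1}$ of maps $b_n\in C^n(R,M)$ of degree $-1$ with $c=m_S\circ(\iota\otimes b+b\otimes\iota)+b\circ m_R$, where $c=(c_n)$, $\iota$ is extended by $0$ to the tensors with at least two factors, and the maps $\iota\otimes b$ and $b\otimes\iota$ are applied, with the Koszul rule, to $\sum_{0<j<n}(a_1\otimes\cdots\otimes a_j)\otimes(a_{j+1}\otimes\cdots\otimes a_n)$. $F$ is trivial if and only if $c_1=0$ and there are $b_n\in C^n(R,M)$ of degree $-1$, $n\ge1$, with $c_n=\partial b_{n-1}$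 for all $n>1$. -/

import Mathlib

open scoped TensorProduct

set_option linter.unusedSectionVars false

noncomputable section

namespace Harrison

/-! ### Graded spaces, graded commutative algebras, symmetric bimodules -/

/-- A `ℤ`-grading of a real vector space. The degree of `a ∈ gr i` is `|a| = i`, and its shifted
degree, i.e. its degree as an element of `V[1]`, is `deg a = i - 1`. -/
structure Grading (V : Type*) [AddCommGroup V] [Module ℝ V] where
  gr : ℤ → Submodule ℝ V
  internal : DirectSum.IsInternal gr

section Graded

variable {V : Type*} [AddCommGroup V] [Module ℝ V]

/-- The decomposition of a graded space as the direct sum of its homogeneous parts. -/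
def Grading.equiv (G : Grading V) : (DirectSum ℤ fun i => G.gr i) ≃ₗ[ℝ] V :=
  LinearEquiv.ofBijective (DirectSum.coeLinearMap G.gr)
    (show Function.Bijective (DirectSum.coeLinearMap G.gr) from G.internal)

theorem Grading.equiv_lof (G : Grading V) {i : ℤ} (v : G.gr i) :
    G.equiv (DirectSum.lof ℝ ℤ (fun i => G.gr i) i v) = v :=
  DirectSum.coeLinearMap_lof G.gr i v

theorem Grading.equiv_symm_coe (G : Grading V) {i : ℤ} (v : G.gr i) :
    G.equiv.symm (v : V) = DirectSum.lof ℝ ℤ (fun i => G.gr i) i v := by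
  rw [LinearEquiv.symm_apply_eq, G.equiv_lof]

/-- The operator `a ↦ (-1)^{d deg a} a`, where `deg a = |a| - 1`. -/
def Grading.sign (G : Grading V) (d : ℤ) : V →ₗ[ℝ] V :=
  DirectSum.toModule ℝ ℤ V (fun i => ((-1 : ℝ) ^ (d * (i - 1))) • (G.gr i).subtype) ∘ₗ
    G.equiv.symm.toLinearMap

theorem Grading.sign_apply (G : Grading V) (d : ℤ) {i : ℤ} (v : G.gr i) :
    G.sign d v = ((-1 : ℝ) ^ (d * (i - 1))) • (v : V) := by
  simp only [Grading.sign, LinearMap.comp_apply, LinearEquiv.coe_coe, G.equiv_symm_coe,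
    DirectSum.toModule_lof]
  rfl

/-- A homogeneous element together with its degree. -/
abbrev Grading.Letter (G : Grading V) := Σ i : ℤ, G.gr i

/-- The shifted degree of a homogeneous element. -/
def Grading.deg (G : Grading V) (x : G.Letter) : ℤ := x.1 - 1

end Graded

/-- A graded commutative (associative, not necessarily unital) real algebra. -/
structure GradedCommAlg (R : Type*) [AddCommGroup R] [Module ℝ R] extends Grading R where
  mul : R →ₗ[ℝ] R →ₗ[ℝ] R
  mul_mem : ∀ {i j : ℤ} {a b : R}, a ∈ gr i → b ∈ gr j → mul a b ∈ gr (i + j)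
  mul_assoc : ∀ a b c : R, mul (mul a b) c = mul a (mul b c)
  mul_comm : ∀ {i j : ℤ} {a b : R}, a ∈ gr i → b ∈ gr j →
    mul a b = ((-1 : ℝ) ^ (i * j)) • mul b a

/-- A graded symmetric bimodule over a graded commutative algebra. -/
structure SymmBimodule {R : Type*} [AddCommGroup R] [Module ℝ R] (A : GradedCommAlg R)
    (M : Type*) [AddCommGroup M] [Module ℝ M] extends Grading M where
  lact : R →ₗ[ℝ] M →ₗ[ℝ] M
  ract : M →ₗ[ℝ] R →ₗ[ℝ] M
  lact_mem : ∀ {i j : ℤ} {a : R} {v : M}, a ∈ A.gr i → v ∈ gr j → lact a v ∈ gr (i + j)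
  lact_lact : ∀ (a b : R) (v : M), lact a (lact b v) = lact (A.mul a b) v
  ract_ract : ∀ (v : M) (a b : R), ract (ract v a) b = ract v (A.mul a b)
  ract_lact : ∀ (a : R) (v : M) (b : R), ract (lact a v) b = lact a (ract v b)
  symm : ∀ {i j : ℤ} {a : R} {v : M}, a ∈ A.gr i → v ∈ gr j →
    ract v a = ((-1 : ℝ) ^ (i * j)) • lact a v

section Semidirect

variable {R M : Type*} [AddCommGroup R] [Module ℝ R] [AddCommGroup M] [Module ℝ M]

theorem SymmBimodule.ract_mem {A : GradedCommAlg R} (B : SymmBimodule A M) {i j : ℤ} {a : R}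
    {v : M} (ha : a ∈ A.gr i) (hv : v ∈ B.gr j) : B.ract v a ∈ B.gr (j + i) := by
  rw [B.symm ha hv, add_comm]
  exact Submodule.smul_mem _ _ (B.lact_mem ha hv)

/-- The direct sum of two graded spaces. -/
def Grading.prod (G : Grading R) (H : Grading M) : Grading (R × M) where
  gr i := (G.gr i).prod (H.gr i)
  internal := by
    let P : ℤ → Submodule ℝ (R × M) := fun i => (G.gr i).prod (H.gr i)
    let f : (DirectSum ℤ fun i => G.gr i) →ₗ[ℝ] (DirectSum ℤ fun i => P i) :=
      DirectSum.toModule ℝ ℤ _ fun i => DirectSum.lof ℝ ℤ (fun i => P i) i ∘ₗ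
        LinearMap.codRestrict (P i) (LinearMap.inl ℝ R M ∘ₗ (G.gr i).subtype)
          (fun x => ⟨x.2, (H.gr i).zero_mem⟩)
    let g : (DirectSum ℤ fun i => H.gr i) →ₗ[ℝ] (DirectSum ℤ fun i => P i) :=
      DirectSum.toModule ℝ ℤ _ fun i => DirectSum.lof ℝ ℤ (fun i => P i) i ∘ₗ
        LinearMap.codRestrict (P i) (LinearMap.inr ℝ R M ∘ₗ (H.gr i).subtype)
          (fun x => ⟨(G.gr i).zero_mem, x.2⟩)
    let inv : R × M →ₗ[ℝ] (DirectSum ℤ fun i => P i) :=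
      LinearMap.coprod (f ∘ₗ G.equiv.symm.toLinearMap) (g ∘ₗ H.equiv.symm.toLinearMap)
    have hl : inv ∘ₗ DirectSum.coeLinearMap P = LinearMap.id := by
      ext i x : 2
      obtain ⟨⟨r, m⟩, hr, hm⟩ := x
      have h1 : G.equiv.symm r = _ := G.equiv_symm_coe ⟨r, hr⟩
      have h2 : H.equiv.symm m = _ := H.equiv_symm_coe ⟨m, hm⟩
      simp only [LinearMap.comp_apply, DirectSum.coeLinearMap_lof, LinearMap.id_apply, inv,
        LinearMap.coprod_apply, LinearEquiv.coe_coe, h1, h2, f, g, DirectSum.toModule_lof]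
      rw [← map_add]
      congr 1
      apply Subtype.ext
      change (r, (0 : M)) + ((0 : R), m) = (r, m)
      simp
    have hr1 : DirectSum.coeLinearMap P ∘ₗ f = LinearMap.inl ℝ R M ∘ₗ G.equiv.toLinearMap := by
      ext i x : 2
      simp only [LinearMap.comp_apply, f, DirectSum.toModule_lof, DirectSum.coeLinearMap_lof,
        LinearEquiv.coe_coe, G.equiv_lof]
      rfl
    have hr2 : DirectSum.coeLinearMap P ∘ₗ g = LinearMap.inr ℝ R M ∘ₗ H.equiv.toLinearMap := by
      ext i x : 2
      simp only [LinearMap.comp_apply, g, DirectSum.toModule_lof, DirectSum.coeLinearMap_lof,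
        LinearEquiv.coe_coe, H.equiv_lof]
      rfl
    refine Function.bijective_iff_has_inverse.2 ⟨inv, fun x => LinearMap.congr_fun hl x, ?_⟩
    rintro ⟨r, m⟩
    have e1 := LinearMap.congr_fun hr1 (G.equiv.symm r)
    have e2 := LinearMap.congr_fun hr2 (H.equiv.symm m)
    simp only [LinearMap.comp_apply, LinearEquiv.coe_coe, LinearEquiv.apply_symm_apply] at e1 e2
    change DirectSum.coeLinearMap P (inv (r, m)) = (r, m)
    simp only [inv, LinearMap.coprod_apply, LinearMap.comp_apply, LinearEquiv.coe_coe, map_add,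
      e1, e2]
    simp

/-- The semidirect product `R ⋉ M`: the graded space `R ⊕ M` with the multiplication
`(a + u)(b + v) = ab + (ub + av)`. -/
def SymmBimodule.semidirect {A : GradedCommAlg R} (B : SymmBimodule A M) :
    GradedCommAlg (R × M) where
  toGrading := A.toGrading.prod B.toGrading
  mul := LinearMap.mk₂ ℝ
    (fun x y => (A.mul x.1 y.1, B.ract x.2 y.1 + B.lact x.1 y.2))
    (by intros; ext <;> simp; abel) (by intros; ext <;> simp)
    (by intros; ext <;> simp; abel) (by intros; ext <;> simp)
  mul_mem := by
    rintro i j ⟨a, u⟩ ⟨b, v⟩ ⟨ha, hu⟩ ⟨hb, hv⟩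
    exact ⟨A.mul_mem ha hb, Submodule.add_mem _ (B.ract_mem hb hu) (B.lact_mem ha hv)⟩
  mul_assoc := by
    rintro ⟨a, u⟩ ⟨b, v⟩ ⟨c, w⟩
    ext
    · simp [A.mul_assoc]
    · simp [B.ract_ract, B.ract_lact, B.lact_lact]
      abel
  mul_comm := by
    rintro i j ⟨a, u⟩ ⟨b, v⟩ ⟨ha, hu⟩ ⟨hb, hv⟩
    ext
    · simpa using A.mul_comm ha hb
    · have e : ((-1 : ℝ) ^ (i * j)) * ((-1 : ℝ) ^ (i * j)) = 1 := by
        rw [← mul_zpow]; norm_num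
      simp only [LinearMap.mk₂_apply, Prod.smul_mk]
      rw [B.symm hb hu, B.symm ha hv, mul_comm j i, smul_add, smul_smul, e, one_smul, add_comm]

end Semidirect

/-! ### Signed sums over words -/

section Words

variable {L N : Type*} [AddCommGroup N] [Module ℝ N]

/-- The degree of a word. -/
def wdeg (deg : L → ℤ) (w : List L) : ℤ := (w.map deg).sum

/-- The signed shuffle of the words `u` and `v`: the sum, over all words `w` which interleave `u`
and `v`, each keeping its own order, of `ε(w) Φ(w)`, where `ε(w)` is the Koszul sign of the
permutation which sorts `w` into `uv`. The interleavings are sorted by their first letter. -/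
def shSum (deg : L → ℤ) : List L → List L → (List L → N) → N
  | [], v, Φ => Φ v
  | a :: u, [], Φ => Φ (a :: u)
  | a :: u, b :: v, Φ =>
      shSum deg u (b :: v) (fun w => Φ (a :: w)) +
        ((-1 : ℝ) ^ (deg b * wdeg deg (a :: u))) •
          shSum deg (a :: u) v (fun w => Φ (b :: w))
  termination_by u v => u.length + v.length

/-- The sum of `± Φ(w)` over all words `w` obtained from the given word `a₀ a₁ ⋯ aₙ` by replacing
two consecutive letters `aⱼ aⱼ₊₁` by their product; the sign is
`(-1)^{deg a₀ + ⋯ + deg aⱼ₋₁}` (Koszul rule) times `(-1)^{deg aⱼ}`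
(as `m(a ⊗ b) = (-1)^{deg a} ab`). -/
def mSum (deg : L → ℤ) (mul : L → L → L) : List L → (List L → N) → N
  | [], _ => 0
  | [_], _ => 0
  | a :: b :: w, Φ =>
      ((-1 : ℝ) ^ deg a) • Φ (mul a b :: w) +
        ((-1 : ℝ) ^ deg a) • mSum deg mul (b :: w) (fun w' => Φ (a :: w'))

/-- The sum of `Φ(u, v)` over all decompositions `w = uv`. -/
def dSum : List L → (List L → List L → N) → N
  | [], Φ => Φ [] []
  | a :: w, Φ => Φ [] (a :: w) + dSum w (fun u v => Φ (a :: u) v)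

theorem sgn_mul (m n : ℤ) : (-1 : ℝ) ^ m * (-1 : ℝ) ^ n = (-1 : ℝ) ^ (m + n) :=
  (zpow_add₀ (by norm_num) m n).symm

theorem sgn_eq {m n : ℤ} (h : Even (m - n)) : (-1 : ℝ) ^ m = (-1 : ℝ) ^ n := by
  have e : m = n + (m - n) := by ring
  rw [e, ← sgn_mul, h.neg_one_zpow, mul_one]

theorem sgn_eq_neg {m n : ℤ} (h : Even (m - n - 1)) : (-1 : ℝ) ^ m = -(-1 : ℝ) ^ n := by
  have e : m = n + 1 + (m - n - 1) := by ring
  rw [e, ← sgn_mul, h.neg_one_zpow, mul_one, ← sgn_mul]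
  simp

section Lemmas

variable (deg : L → ℤ) (mul : L → L → L)

@[simp] theorem wdeg_nil : wdeg deg [] = 0 := rfl

@[simp] theorem wdeg_cons (a : L) (w : List L) : wdeg deg (a :: w) = deg a + wdeg deg w := by
  simp [wdeg]

@[simp] theorem wdeg_append (u w : List L) : wdeg deg (u ++ w) = wdeg deg u + wdeg deg w := by
  simp [wdeg]

theorem shSum_nil_left (v : List L) (Φ : List L → N) : shSum deg [] v Φ = Φ v := by
  rw [shSum]

theorem shSum_nil_right (u : List L) (Φ : List L → N) : shSum deg u [] Φ = Φ u := by
  cases u <;> rw [shSum]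

theorem shSum_cons (a b : L) (u v : List L) (Φ : List L → N) :
    shSum deg (a :: u) (b :: v) Φ = shSum deg u (b :: v) (fun w => Φ (a :: w)) +
        ((-1 : ℝ) ^ (deg b * wdeg deg (a :: u))) •
          shSum deg (a :: u) v (fun w => Φ (b :: w)) := by
  rw [shSum]

theorem shSum_congr (u v : List L) (Φ Ψ : List L → N)
    (h : ∀ w, w.Perm (u ++ v) → Φ w = Ψ w) : shSum deg u v Φ = shSum deg u v Ψ := by
  induction u, v, Φ using shSum.induct generalizing Ψ with
  | case1 v Φ => simpa [shSum_nil_left] using h v (by simp)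
  | case2 a u Φ => simpa [shSum_nil_right] using h (a :: u) (by simp)
  | case3 a u b v Φ ih1 ih2 =>
    rw [shSum_cons, shSum_cons, ih1 (fun w => Ψ (a :: w)), ih2 (fun w => Ψ (b :: w))]
    · intro w hw
      exact h _ ((List.Perm.cons b hw).trans List.perm_middle.symm)
    · intro w hw
      exact h _ (List.Perm.cons a hw)

theorem shSum_map {N' : Type*} [AddCommGroup N'] [Module ℝ N'] (f : N →ₗ[ℝ] N') (u v : List L)
    (Φ : List L → N) : f (shSum deg u v Φ) = shSum deg u v (fun w => f (Φ w)) := by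
  induction u, v, Φ using shSum.induct with
  | case1 v Φ => simp [shSum_nil_left]
  | case2 a u Φ => simp [shSum_nil_right]
  | case3 a u b v Φ ih1 ih2 => simp only [shSum_cons, map_add, map_smul, ih1, ih2]

theorem shSum_add (u v : List L) (Φ Ψ : List L → N) :
    shSum deg u v (fun w => Φ w + Ψ w) = shSum deg u v Φ + shSum deg u v Ψ := by
  induction u, v, Φ using shSum.induct generalizing Ψ with
  | case1 v Φ => simp [shSum_nil_left]
  | case2 a u Φ => simp [shSum_nil_right]
  | case3 a u b v Φ ih1 ih2 => simp only [shSum_cons, ih1, ih2, smul_add]; abel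

theorem shSum_smul (c : ℝ) (u v : List L) (Φ : List L → N) :
    shSum deg u v (fun w => c • Φ w) = c • shSum deg u v Φ :=
  (shSum_map deg (LinearMap.lsmul ℝ N c) u v Φ).symm

theorem shSum_zero (u v : List L) : shSum deg u v (fun _ => (0 : N)) = 0 := by
  simpa using shSum_smul deg (0 : ℝ) u v (fun _ => (0 : N))

/-- The words obtained by multiplying two consecutive letters. -/
def merges : List L → List (List L)
  | [] => []
  | [_] => []
  | a :: b :: w => (mul a b :: w) :: (merges (b :: w)).map (fun w' => a :: w')

variable {deg mul}

theorem mSum_congr (l : List L) (Φ Ψ : List L → N)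
    (h : ∀ w ∈ merges mul l, Φ w = Ψ w) : mSum deg mul l Φ = mSum deg mul l Ψ := by
  induction l generalizing Φ Ψ with
  | nil => rfl
  | cons a l ih =>
    cases l with
    | nil => rfl
    | cons b w =>
      simp only [mSum]
      rw [h _ (by simp [merges]), ih (fun w => Φ (a :: w)) (fun w => Ψ (a :: w))]
      intro w' hw'
      exact h _ (by simp [merges, hw'])

theorem wdeg_merges (hd : ∀ a b, deg (mul a b) = deg a + deg b + 1) (l w : List L)
    (h : w ∈ merges mul l) : wdeg deg w = wdeg deg l + 1 := by
  induction l generalizing w with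
  | nil => simp [merges] at h
  | cons a l ih =>
    cases l with
    | nil => simp [merges] at h
    | cons b l =>
      simp only [merges, List.mem_cons, List.mem_map] at h
      rcases h with rfl | ⟨w', hw', rfl⟩
      · simp [hd]; ring
      · rw [wdeg_cons, ih w' hw', wdeg_cons deg a]; ring

theorem length_merges (l w : List L) (h : w ∈ merges mul l) : w.length + 1 = l.length := by
  induction l generalizing w with
  | nil => simp [merges] at h
  | cons a l ih =>
    cases l with
    | nil => simp [merges] at h
    | cons b l =>
      simp only [merges, List.mem_cons, List.mem_map] at h
      rcases h with rfl | ⟨w', hw', rfl⟩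
      · simp
      · have := ih w' hw'
        simp at this ⊢
        omega

theorem mSum_map {N' : Type*} [AddCommGroup N'] [Module ℝ N'] (f : N →ₗ[ℝ] N') (l : List L)
    (Φ : List L → N) : f (mSum deg mul l Φ) = mSum deg mul l (fun w => f (Φ w)) := by
  induction l generalizing Φ with
  | nil => simp [mSum]
  | cons a l ih =>
    cases l with
    | nil => simp [mSum]
    | cons b w => simp only [mSum, map_add, map_smul, ih]

theorem mSum_add (l : List L) (Φ Ψ : List L → N) :
    mSum deg mul l (fun w => Φ w + Ψ w) = mSum deg mul l Φ + mSum deg mul l Ψ := by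
  induction l generalizing Φ Ψ with
  | nil => simp [mSum]
  | cons a l ih =>
    cases l with
    | nil => simp [mSum]
    | cons b w => simp only [mSum, ih, smul_add]; abel

theorem mSum_smul (c : ℝ) (l : List L) (Φ : List L → N) :
    mSum deg mul l (fun w => c • Φ w) = c • mSum deg mul l Φ :=
  (mSum_map (LinearMap.lsmul ℝ N c) l Φ).symm

theorem mSum_mem (P : Submodule ℝ N) (l : List L) (Φ : List L → N)
    (h : ∀ w ∈ merges mul l, Φ w ∈ P) : mSum deg mul l Φ ∈ P := by
  induction l generalizing Φ with
  | nil => exact P.zero_mem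
  | cons a l ih =>
    cases l with
    | nil => exact P.zero_mem
    | cons b w =>
      refine P.add_mem (P.smul_mem _ (h _ (by simp [merges])))
        (P.smul_mem _ (ih _ fun w' hw' => h _ (by simp [merges, hw'])))

/-- The contribution of the products `a c`, `c` the first letter of the word. -/
def headTerm (deg : L → ℤ) (mul : L → L → L) (a : L) (Φ : List L → N) : List L → N
  | [] => 0
  | c :: w => ((-1 : ℝ) ^ deg a) • Φ (mul a c :: w)

theorem mSum_cons (a : L) (l : List L) (Φ : List L → N) :
    mSum deg mul (a :: l) Φ = headTerm deg mul a Φ l +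
      ((-1 : ℝ) ^ deg a) • mSum deg mul l (fun w => Φ (a :: w)) := by
  cases l <;> simp [mSum, headTerm]

/-- `m` is a derivation of the shuffle product. -/
theorem shSum_mSum (hd : ∀ a b, deg (mul a b) = deg a + deg b + 1) (u v : List L)
    (Φ : List L → N)
    (hΦ : ∀ p a b w, Φ (p ++ mul a b :: w) =
      ((-1 : ℝ) ^ ((deg a + 1) * (deg b + 1))) • Φ (p ++ mul b a :: w)) :
    shSum deg u v (fun w => mSum deg mul w Φ) =
      mSum deg mul u (fun u' => shSum deg u' v Φ) +
        ((-1 : ℝ) ^ wdeg deg u) • mSum deg mul v (fun v' => shSum deg u v' Φ) := by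
  induction u, v, Φ using shSum.induct with
  | case1 v Φ => simp [shSum_nil_left, mSum]
  | case2 a u Φ => simp [shSum_nil_right, mSum]
  | case3 a u b v Φ ih1 ih2 =>
    have hΦ' : ∀ c : L, ∀ p a b w, Φ (c :: (p ++ mul a b :: w)) =
      ((-1 : ℝ) ^ ((deg a + 1) * (deg b + 1))) • Φ (c :: (p ++ mul b a :: w)) :=
      fun c p a b w => hΦ (c :: p) a b w
    have i1 := ih1 (hΦ' a)
    have i2 := ih2 (hΦ' b)
    have k1 : shSum deg u (b :: v) (headTerm deg mul a Φ) =
        headTerm deg mul a (fun u' => shSum deg u' (b :: v) Φ) u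
        - ((-1 : ℝ) ^ (deg b * (deg a + wdeg deg u) + deg b)) •
            headTerm deg mul a (fun u' => shSum deg u' v (fun w => Φ (b :: w))) u
        + ((-1 : ℝ) ^ (deg a + deg b * wdeg deg u)) •
            shSum deg u v (fun w => Φ (mul a b :: w)) := by
      cases u with
      | nil => simp [shSum_nil_left, headTerm]
      | cons c u' =>
        rw [shSum_cons]
        simp only [headTerm]
        rw [shSum_smul, shSum_smul, shSum_cons deg (mul a c)]
        have e : deg b * wdeg deg (mul a c :: u') =
            deg b * (deg a + wdeg deg (c :: u')) + deg b := by
          simp [hd]; ring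
        rw [e, ← sgn_mul (deg a)]
        module
    have k2 : shSum deg (a :: u) v (headTerm deg mul b Φ) =
        ((-1 : ℝ) ^ ((deg b + 1) * (deg a + wdeg deg u))) •
          (headTerm deg mul b (fun v' => shSum deg (a :: u) v' Φ) v -
            headTerm deg mul b (fun v' => shSum deg u v' (fun w => Φ (a :: w))) v) +
        ((-1 : ℝ) ^ deg b) • shSum deg u v (fun w => Φ (mul b a :: w)) := by
      cases v with
      | nil => simp [shSum_nil_right, headTerm]
      | cons c v' =>
        rw [shSum_cons]
        simp only [headTerm]
        rw [shSum_smul, shSum_smul, shSum_cons deg a (mul b c)]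
        have e : (-1 : ℝ) ^ (deg c * wdeg deg (a :: u)) =
            (-1 : ℝ) ^ ((deg b + 1) * (deg a + wdeg deg u)) *
              (-1 : ℝ) ^ (deg (mul b c) * wdeg deg (a :: u)) := by
          rw [sgn_mul]
          refine sgn_eq ⟨-((deg b + 1) * (deg a + wdeg deg u)), ?_⟩
          simp [hd]; ring
        rw [e]
        module
    have k3 : mSum deg mul u (fun u' => shSum deg (a :: u') (b :: v) Φ) =
        mSum deg mul u (fun u' => shSum deg u' (b :: v) (fun w => Φ (a :: w))) +
        ((-1 : ℝ) ^ (deg b * (deg a + wdeg deg u) + deg b)) •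
          mSum deg mul u (fun u' => shSum deg (a :: u') v (fun w => Φ (b :: w))) := by
      rw [← mSum_smul, ← mSum_add]
      refine mSum_congr _ _ _ fun w hw => ?_
      rw [shSum_cons, wdeg_cons, wdeg_merges hd u w hw]
      congr 3
      ring
    have k4 : mSum deg mul v (fun v' => shSum deg (a :: u) (b :: v') Φ) =
        mSum deg mul v (fun v' => shSum deg u (b :: v') (fun w => Φ (a :: w))) +
        ((-1 : ℝ) ^ (deg b * (deg a + wdeg deg u))) •
          mSum deg mul v (fun v' => shSum deg (a :: u) v' (fun w => Φ (b :: w))) := by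
      rw [← mSum_smul, ← mSum_add]
      refine mSum_congr _ _ _ fun w hw => ?_
      rw [shSum_cons, wdeg_cons]
    have k5 : shSum deg u v (fun w => Φ (mul a b :: w)) =
        ((-1 : ℝ) ^ ((deg a + 1) * (deg b + 1))) •
          shSum deg u v (fun w => Φ (mul b a :: w)) := by
      rw [← shSum_smul]
      exact shSum_congr _ _ _ _ _ fun w _ => hΦ [] a b w
    have s1 : (-1 : ℝ) ^ (deg a + deg b * wdeg deg u) *
          (-1 : ℝ) ^ ((deg a + 1) * (deg b + 1)) =
        -((-1 : ℝ) ^ (deg b * (deg a + wdeg deg u)) * (-1 : ℝ) ^ deg b) := by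
      rw [sgn_mul, sgn_mul]
      exact sgn_eq_neg ⟨deg a, by ring⟩
    have s2 : (-1 : ℝ) ^ (deg b * (deg a + wdeg deg u) + deg b) =
        (-1 : ℝ) ^ (deg b * (deg a + wdeg deg u)) * (-1 : ℝ) ^ deg b := (sgn_mul _ _).symm
    have s3 : (-1 : ℝ) ^ ((deg b + 1) * (deg a + wdeg deg u)) =
        (-1 : ℝ) ^ (deg b * (deg a + wdeg deg u)) *
          ((-1 : ℝ) ^ deg a * (-1 : ℝ) ^ wdeg deg u) := by
      rw [sgn_mul, sgn_mul]
      congr 1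
      ring
    have s4 : (-1 : ℝ) ^ (deg a + wdeg deg u) = (-1 : ℝ) ^ deg a * (-1 : ℝ) ^ wdeg deg u :=
      (sgn_mul _ _).symm
    have sq : ∀ n : ℤ, (-1 : ℝ) ^ n * (-1 : ℝ) ^ n = 1 := fun n => by
      rw [← mul_zpow]; norm_num
    rw [shSum_cons]
    simp only [mSum_cons]
    rw [shSum_add, shSum_add, shSum_smul, shSum_smul, i1, i2, mSum_cons b, mSum_cons a, k1, k2,
      k3, k4, k5]
    simp only [wdeg_cons]
    rw [s2, s3, s4, smul_smul ((-1 : ℝ) ^ (deg a + deg b * wdeg deg u)), s1]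
    have q1 := sq (deg b * (deg a + wdeg deg u))
    have q2 := sq (deg b)
    generalize (-1 : ℝ) ^ (deg b * (deg a + wdeg deg u)) = σ at *
    generalize (-1 : ℝ) ^ deg b = β at *
    generalize (-1 : ℝ) ^ deg a = α at *
    generalize (-1 : ℝ) ^ wdeg deg u = υ at *
    match_scalars <;> first | ring1 | linear_combination (α * υ) * q1 |
      linear_combination (-(α * υ)) * q1

theorem dSum_congr (l : List L) (Φ Ψ : List L → List L → N)
    (h : ∀ u v, u ++ v = l → Φ u v = Ψ u v) : dSum l Φ = dSum l Ψ := by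
  induction l generalizing Φ Ψ with
  | nil => exact h [] [] rfl
  | cons a l ih =>
    simp only [dSum]
    rw [h [] (a :: l) rfl, ih (fun u v => Φ (a :: u) v) (fun u v => Ψ (a :: u) v)]
    intro u v huv
    exact h _ _ (by simp [huv])

theorem dSum_map {N' : Type*} [AddCommGroup N'] [Module ℝ N'] (f : N →ₗ[ℝ] N') (l : List L)
    (Φ : List L → List L → N) : f (dSum l Φ) = dSum l (fun u v => f (Φ u v)) := by
  induction l generalizing Φ with
  | nil => rfl
  | cons a l ih => simp only [dSum, map_add, ih]

theorem dSum_add (l : List L) (Φ Ψ : List L → List L → N) :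
    dSum l (fun u v => Φ u v + Ψ u v) = dSum l Φ + dSum l Ψ := by
  induction l generalizing Φ Ψ with
  | nil => rfl
  | cons a l ih => simp only [dSum, ih]; abel

theorem dSum_sub (l : List L) (Φ Ψ : List L → List L → N) :
    dSum l (fun u v => Φ u v - Ψ u v) = dSum l Φ - dSum l Ψ := by
  induction l generalizing Φ Ψ with
  | nil => rfl
  | cons a l ih => simp only [dSum, ih]; abel

theorem dSum_smul (c : ℝ) (l : List L) (Φ : List L → List L → N) :
    dSum l (fun u v => c • Φ u v) = c • dSum l Φ :=
  (dSum_map (LinearMap.lsmul ℝ N c) l Φ).symm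

theorem dSum_zero (l : List L) : dSum l (fun _ _ => (0 : N)) = 0 := by
  simpa using dSum_smul (0 : ℝ) l (fun _ _ => (0 : N))

theorem dSum_ends (l : List L) (hl : l ≠ []) (Φ : List L → List L → N)
    (h : ∀ u v, u ≠ [] → v ≠ [] → u ++ v = l → Φ u v = 0) :
    dSum l Φ = Φ [] l + Φ l [] := by
  have aux : ∀ (l : List L) (Φ : List L → List L → N),
      (∀ u v, v ≠ [] → u ++ v = l → Φ u v = 0) → dSum l Φ = Φ l [] := by
    intro l
    induction l with
    | nil => intro Φ _; rfl
    | cons a l ih =>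
      intro Φ h
      simp only [dSum]
      rw [h [] (a :: l) (by simp) rfl, zero_add, ih]
      intro u v hv huv
      exact h _ _ hv (by simp [huv])
  cases l with
  | nil => exact absurd rfl hl
  | cons a l =>
    simp only [dSum]
    rw [aux]
    intro u v hv huv
    exact h _ _ (by simp) hv (by simp [huv])

/-- Deconcatenation is multiplicative for the shuffle product. -/
theorem shSum_dSum (u v : List L) (Ψ : List L → List L → N) :
    shSum deg u v (fun w => dSum w Ψ) =
      dSum u (fun u₁ u₂ => dSum v (fun v₁ v₂ => ((-1 : ℝ) ^ (wdeg deg u₂ * wdeg deg v₁)) •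
        shSum deg u₁ v₁ (fun w₁ => shSum deg u₂ v₂ (fun w₂ => Ψ w₁ w₂)))) := by
  obtain ⟨n, hn⟩ : ∃ n, n = u.length + v.length := ⟨_, rfl⟩
  induction n using Nat.strong_induction_on generalizing u v Ψ with
  | _ n ih =>
  cases u with
  | nil => simp [dSum, shSum_nil_left]
  | cons a u =>
  cases v with
  | nil => simp [dSum, shSum_nil_right]
  | cons b v =>
    have i1 := ih _ (by simp at hn; simp; omega) u (b :: v) (fun x y => Ψ (a :: x) y) rfl
    have i2 := ih _ (by simp at hn; simp; omega) (a :: u) v (fun x y => Ψ (b :: x) y) rfl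
    rw [shSum_cons]
    simp only [dSum]
    rw [shSum_add, shSum_add, i1, i2]
    simp only [dSum, shSum_nil_left, shSum_nil_right, wdeg_nil, mul_zero, zpow_zero, one_smul,
      dSum_add]
    have e1 : dSum u (fun u₁ u₂ => dSum v (fun v₁ v₂ =>
          ((-1 : ℝ) ^ (wdeg deg u₂ * wdeg deg (b :: v₁))) •
            shSum deg (a :: u₁) (b :: v₁) (fun w₁ => shSum deg u₂ v₂ (fun w₂ => Ψ w₁ w₂)))) =
        dSum u (fun u₁ u₂ => dSum v (fun v₁ v₂ =>
          ((-1 : ℝ) ^ (wdeg deg u₂ * wdeg deg (b :: v₁))) •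
            shSum deg u₁ (b :: v₁) (fun w₁ => shSum deg u₂ v₂ (fun w₂ => Ψ (a :: w₁) w₂)))) +
        ((-1 : ℝ) ^ (deg b * wdeg deg (a :: u))) •
        dSum u (fun u₁ u₂ => dSum v (fun v₁ v₂ =>
          ((-1 : ℝ) ^ (wdeg deg u₂ * wdeg deg v₁)) •
            shSum deg (a :: u₁) v₁ (fun w₁ => shSum deg u₂ v₂ (fun w₂ => Ψ (b :: w₁) w₂)))) := by
      rw [← dSum_smul, ← dSum_add]
      refine dSum_congr _ _ _ fun u₁ u₂ hu => ?_
      rw [← dSum_smul, ← dSum_add]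
      refine dSum_congr _ _ _ fun v₁ v₂ _ => ?_
      rw [shSum_cons, smul_add, smul_smul, smul_smul, sgn_mul, sgn_mul]
      congr 3
      subst hu
      simp
      ring
    have e2 : dSum v (fun v₁ v₂ => ((-1 : ℝ) ^ (wdeg deg (a :: u) * wdeg deg (b :: v₁))) •
          shSum deg (a :: u) v₂ (fun w₂ => Ψ (b :: v₁) w₂)) =
        ((-1 : ℝ) ^ (deg b * wdeg deg (a :: u))) •
        dSum v (fun v₁ v₂ => ((-1 : ℝ) ^ (wdeg deg (a :: u) * wdeg deg v₁)) •
          shSum deg (a :: u) v₂ (fun w₂ => Ψ (b :: v₁) w₂)) := by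
      rw [← dSum_smul]
      refine dSum_congr _ _ _ fun v₁ v₂ _ => ?_
      rw [smul_smul, sgn_mul]
      congr 2
      simp
      ring
    rw [e1, e2, shSum_cons]
    module

/-- Modulo shuffles, the deconcatenation of a shuffle of `u` and `v` is `u ⊗ v ± v ⊗ u`. -/
theorem shSum_dSum_bilin {N' : Type*} [AddCommGroup N'] [Module ℝ N']
    (β : N →ₗ[ℝ] N →ₗ[ℝ] N') (φ : List L → N)
    (h0 : φ [] = 0) (h : ∀ u v, u ≠ [] → v ≠ [] → shSum deg u v φ = 0)
    (u v : List L) (hu : u ≠ []) (hv : v ≠ []) :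
    shSum deg u v (fun w => dSum w (fun x y => β (φ x) (φ y))) =
      β (φ u) (φ v) + ((-1 : ℝ) ^ (wdeg deg u * wdeg deg v)) • β (φ v) (φ u) := by
  have key : ∀ u₁ u₂ v₁ v₂ : List L,
      shSum deg u₁ v₁ (fun w₁ => shSum deg u₂ v₂ (fun w₂ => β (φ w₁) (φ w₂))) =
        β (shSum deg u₁ v₁ φ) (shSum deg u₂ v₂ φ) := by
    intro u₁ u₂ v₁ v₂
    have : ∀ x, shSum deg u₂ v₂ (fun w₂ => β x (φ w₂)) = β.flip (shSum deg u₂ v₂ φ) x :=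
      fun x => (shSum_map deg (β x) u₂ v₂ φ).symm
    simp only [this]
    exact (shSum_map deg _ u₁ v₁ φ).symm
  rw [shSum_dSum]
  simp only [key]
  rw [dSum_ends u hu]
  · rw [dSum_ends v hv, dSum_ends v hv]
    · simp [shSum_nil_left, shSum_nil_right, h0]
      abel
    · intro v₁ v₂ h1 h2 _
      simp [h u v₁ hu h1]
    · intro v₁ v₂ h1 h2 _
      simp [h u v₂ hu h2]
  · intro u₁ u₂ h1 h2 _
    rw [← dSum_zero v]
    refine dSum_congr _ _ _ fun v₁ v₂ hvv => ?_
    by_cases hv1 : v₁ = []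
    · have : v₂ ≠ [] := by
        rintro rfl
        subst hv1
        exact hv (by simpa using hvv.symm)
      simp [h u₂ v₂ h2 this]
    · simp [h u₁ v₁ h1 hv1]

end Lemmas

end Words

/-! ### The tensor algebra and its deconcatenation -/

section Tensor

variable {V : Type*} [AddCommGroup V] [Module ℝ V]

/-- The tensor algebra `⨁ₙ ⊗ⁿ V`. -/
abbrev Tens (V : Type*) [AddCommGroup V] [Module ℝ V] := TensorAlgebra ℝ V

section Recursion

variable {N : Type*} [AddCommGroup N] [Module ℝ N]

/-- Linear recursion on tensors: the linear map `φ` with `φ(1) = n₀` and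
`φ(a ⊗ t) = g(a, t) + s(a)(φ(t))`. -/
def tensRec (g : V →ₗ[ℝ] Tens V →ₗ[ℝ] N) (s : V →ₗ[ℝ] Module.End ℝ N) (n₀ : N) :
    Tens V →ₗ[ℝ] N :=
  LinearMap.snd ℝ (Tens V) N ∘ₗ LinearMap.applyₗ ((1, n₀) : Tens V × N) ∘ₗ
    (TensorAlgebra.lift ℝ (LinearMap.mk₂ ℝ
      (fun (a : V) (p : Tens V × N) => (TensorAlgebra.ι ℝ a * p.1, g a p.1 + s a p.2))
      (by intros; ext <;> simp [add_mul]; abel) (by intros; ext <;> simp)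
      (by intros; ext <;> simp [mul_add]; abel) (by intros; ext <;> simp) :
      V →ₗ[ℝ] Module.End ℝ (Tens V × N))).toLinearMap

variable (g : V →ₗ[ℝ] Tens V →ₗ[ℝ] N) (s : V →ₗ[ℝ] Module.End ℝ N) (n₀ : N)

theorem tensRec_one : tensRec g s n₀ 1 = n₀ := by
  simp [tensRec]

theorem tensRec_mul (a : V) (t : Tens V) :
    tensRec g s n₀ (TensorAlgebra.ι ℝ a * t) = g a t + s a (tensRec g s n₀ t) := by
  set f : V →ₗ[ℝ] Module.End ℝ (Tens V × N) := LinearMap.mk₂ ℝ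
      (fun (a : V) (p : Tens V × N) => (TensorAlgebra.ι ℝ a * p.1, g a p.1 + s a p.2))
      (by intros; ext <;> simp [add_mul]; abel) (by intros; ext <;> simp)
      (by intros; ext <;> simp [mul_add]; abel) (by intros; ext <;> simp) with hf
  have key : ∀ (x : Tens V) (p : Tens V × N),
      ((TensorAlgebra.lift ℝ f x) p).1 = x * p.1 := by
    intro x
    induction x using TensorAlgebra.induction with
    | algebraMap r => intro p; simp [Algebra.smul_def]
    | ι a => intro p; simp [hf]
    | mul x y hx hy => intro p; simp [hx, hy, mul_assoc]
    | add x y hx hy => intro p; simp [hx, hy, add_mul]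
  have k := key t (1, n₀)
  change ((TensorAlgebra.lift ℝ f (TensorAlgebra.ι ℝ a * t)) (1, n₀)).2 =
    g a t + s a ((TensorAlgebra.lift ℝ f t) (1, n₀)).2
  rw [map_mul, TensorAlgebra.lift_ι_apply, Module.End.mul_apply]
  simp only [hf, LinearMap.mk₂_apply]
  rw [← hf, k, mul_one]

end Recursion

/-- Left multiplication by an element of `V`. -/
def lmul : V →ₗ[ℝ] Module.End ℝ (Tens V) := LinearMap.mul ℝ (Tens V) ∘ₗ TensorAlgebra.ι ℝ

@[simp] theorem lmul_apply (a : V) (t : Tens V) : lmul a t = TensorAlgebra.ι ℝ a * t := rfl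

@[simp] theorem algebraMapInv_ι (a : V) :
    TensorAlgebra.algebraMapInv (TensorAlgebra.ι ℝ a) = (0 : ℝ) := by
  simp [TensorAlgebra.algebraMapInv]

/-- The full deconcatenation `a₁ ⊗ ⋯ ⊗ aₙ ↦ ∑_{0 ≤ j ≤ n} (a₁ ⊗ ⋯ ⊗ aⱼ) ⊗ (aⱼ₊₁ ⊗ ⋯ ⊗ aₙ)`. -/
def decon : Tens V →ₗ[ℝ] Tens V ⊗[ℝ] Tens V :=
  tensRec (lmul.compr₂ (TensorProduct.mk ℝ (Tens V) (Tens V) 1))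
    (LinearMap.rTensorHom (Tens V) ∘ₗ lmul) (1 ⊗ₜ 1)

/-- The projection of `⨁ₙ ⊗ⁿ V` onto `⊗¹ V = V`. -/
def prT : Tens V →ₗ[ℝ] V :=
  tensRec ((LinearMap.lsmul ℝ V).flip.compl₂ TensorAlgebra.algebraMapInv.toLinearMap) 0 0

/-- `a₁ ⊗ ⋯ ⊗ aₙ ↦ a₁ ⊗ (a₂ ⊗ ⋯ ⊗ aₙ)`, and `1 ↦ 0`. -/
def firstSplit : Tens V →ₗ[ℝ] V ⊗[ℝ] Tens V :=
  tensRec (TensorProduct.mk ℝ V (Tens V)) 0 0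

/-- `a₁ ⊗ ⋯ ⊗ aₙ ↦ (a₁ ⊗ ⋯ ⊗ aₙ₋₁) ⊗ aₙ`, and `1 ↦ 0`. -/
def lastSplit : Tens V →ₗ[ℝ] Tens V ⊗[ℝ] V :=
  tensRec (((LinearMap.lsmul ℝ (Tens V ⊗[ℝ] V)).flip.compl₂
      TensorAlgebra.algebraMapInv.toLinearMap) ∘ₗ TensorProduct.mk ℝ (Tens V) V 1)
    (LinearMap.rTensorHom V ∘ₗ lmul) 0

namespace Grading

variable (G : Grading V)

/-- The tensor `a₁ ⊗ ⋯ ⊗ aₙ` of a word of homogeneous elements. -/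
def word : List G.Letter → Tens V
  | [] => 1
  | a :: w => TensorAlgebra.ι ℝ (a.2 : V) * word w

theorem word_append (u w : List G.Letter) : G.word (u ++ w) = G.word u * G.word w := by
  induction u with
  | nil => simp [word]
  | cons a u ih => simp [word, ih, mul_assoc]

theorem decon_word (w : List G.Letter) :
    decon (G.word w) = dSum w (fun u v => G.word u ⊗ₜ[ℝ] G.word v) := by
  induction w with
  | nil => exact tensRec_one _ _ _
  | cons a w ih =>
    rw [word, decon, tensRec_mul, ← decon, ih]
    simp only [dSum, LinearMap.comp_apply, dSum_map]
    rfl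

theorem prT_nil : prT (G.word []) = 0 := tensRec_one _ _ _

theorem prT_singleton (a : G.Letter) : prT (G.word [a]) = (a.2 : V) := by
  rw [word, prT, tensRec_mul]
  simp [word]

theorem prT_cons_cons (a b : G.Letter) (w : List G.Letter) : prT (G.word (a :: b :: w)) = 0 := by
  simp [word, prT, tensRec_mul]

theorem firstSplit_cons (a : G.Letter) (w : List G.Letter) :
    firstSplit (G.word (a :: w)) = (a.2 : V) ⊗ₜ G.word w := by
  simp [word, firstSplit, tensRec_mul]

theorem lastSplit_nil : lastSplit (G.word []) = 0 := tensRec_one _ _ _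

theorem lastSplit_singleton (a : G.Letter) : lastSplit (G.word [a]) = 1 ⊗ₜ (a.2 : V) := by
  rw [word, lastSplit, tensRec_mul, word, tensRec_one]
  simp

theorem lastSplit_cons_cons (a b : G.Letter) (w : List G.Letter) :
    lastSplit (G.word (a :: b :: w)) =
      LinearMap.rTensor V (lmul (a.2 : V)) (lastSplit (G.word (b :: w))) := by
  rw [word, lastSplit, tensRec_mul]
  simp [word]

/-- The operator `t ↦ (-1)^{deg t} t` on tensors, for the shifted degree. -/
def signT : Tens V →ₗ[ℝ] Tens V :=
  (TensorAlgebra.lift ℝ (TensorAlgebra.ι ℝ ∘ₗ G.sign 1)).toLinearMap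

theorem signT_word (w : List G.Letter) :
    G.signT (G.word w) = ((-1 : ℝ) ^ wdeg G.deg w) • G.word w := by
  induction w with
  | nil => simp [signT, word]
  | cons a w ih =>
    simp only [signT, AlgHom.toLinearMap_apply] at ih
    simp only [signT, word, AlgHom.toLinearMap_apply, map_mul, TensorAlgebra.lift_ι_apply,
      LinearMap.comp_apply, ih, G.sign_apply, map_smul, one_mul, wdeg_cons]
    rw [smul_mul_smul_comm, sgn_mul]
    rfl

/-- The flip `x ⊗ y ↦ (-1)^{deg x deg y} y ⊗ x`. On homogeneous `x`, `y` the scalar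
`(1 + (-1)^{deg x} + (-1)^{deg y} - (-1)^{deg x + deg y}) / 2` is `(-1)^{deg x deg y}`. -/
def flip : Tens V ⊗[ℝ] Tens V →ₗ[ℝ] Tens V ⊗[ℝ] Tens V :=
  (TensorProduct.comm ℝ (Tens V) (Tens V)).toLinearMap ∘ₗ ((1 / 2 : ℝ) •
    (LinearMap.id + TensorProduct.map G.signT LinearMap.id
      + TensorProduct.map LinearMap.id G.signT - TensorProduct.map G.signT G.signT))

theorem sgn_half (m n : ℤ) : (1 / 2 : ℝ) * (1 + (-1 : ℝ) ^ m + (-1 : ℝ) ^ n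
    - (-1 : ℝ) ^ m * (-1 : ℝ) ^ n) = (-1 : ℝ) ^ (m * n) := by
  rcases Int.even_or_odd m with hm | hm <;> rcases Int.even_or_odd n with hn | hn
  · rw [hm.neg_one_zpow, hn.neg_one_zpow, (hm.mul_right n).neg_one_zpow]; norm_num
  · rw [hm.neg_one_zpow, hn.neg_one_zpow, (hm.mul_right n).neg_one_zpow]; norm_num
  · rw [hm.neg_one_zpow, hn.neg_one_zpow, (hn.mul_left m).neg_one_zpow]; norm_num
  · rw [hm.neg_one_zpow, hn.neg_one_zpow, (hm.mul hn).neg_one_zpow]; norm_num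

theorem flip_word (u v : List G.Letter) :
    G.flip (G.word u ⊗ₜ G.word v) =
      ((-1 : ℝ) ^ (wdeg G.deg u * wdeg G.deg v)) • (G.word v ⊗ₜ G.word u) := by
  rw [← sgn_half]
  simp only [flip, LinearMap.comp_apply, LinearMap.smul_apply, LinearMap.add_apply,
    LinearMap.sub_apply, LinearMap.id_apply, TensorProduct.map_tmul, signT_word, map_smul,
    map_add, map_sub, LinearEquiv.coe_coe, TensorProduct.comm_tmul, TensorProduct.tmul_smul,
    ← TensorProduct.smul_tmul', smul_smul]
  module

/-! ### The Lie coalgebra `⨁_{n ≥ 1} ⊗ⁿ V[1] / shuffles` -/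

/-- The span of all shuffles `bat_{p,q}(α, β)` of non-empty words. -/
def shuffles : Submodule ℝ (Tens V) :=
  Submodule.span ℝ {x | ∃ u v : List G.Letter, u ≠ [] ∧ v ≠ [] ∧ x = shSum G.deg u v G.word}

/-- The space `⨁_{n ≥ 1} ⊗ⁿ V[1] / shuffles`, as the quotient of `⨁_{n ≥ 0} ⊗ⁿ V[1]` by the
constants `⊗⁰ V[1] = ℝ · 1` and the shuffles. -/
abbrev CInf := Tens V ⧸ (Submodule.span ℝ {(1 : Tens V)} ⊔ G.shuffles)

/-- The class of a tensor. -/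
def cls : Tens V →ₗ[ℝ] G.CInf :=
  Submodule.mkQ (Submodule.span ℝ {(1 : Tens V)} ⊔ G.shuffles)

theorem cls_one : G.cls 1 = 0 :=
  (Submodule.Quotient.mk_eq_zero _).2 (Submodule.mem_sup_left (Submodule.mem_span_singleton_self _))

theorem cls_shSum (u v : List G.Letter) (hu : u ≠ []) (hv : v ≠ []) :
    G.cls (shSum G.deg u v G.word) = 0 :=
  (Submodule.Quotient.mk_eq_zero _).2
    (Submodule.mem_sup_right (Submodule.subset_span ⟨u, v, hu, hv, rfl⟩))

theorem shSum_cls_word (u v : List G.Letter) (hu : u ≠ []) (hv : v ≠ []) :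
    shSum G.deg u v (fun w => G.cls (G.word w)) = 0 := by
  rw [← shSum_map, G.cls_shSum u v hu hv]

theorem le_ker {N : Type*} [AddCommGroup N] [Module ℝ N] (f : Tens V →ₗ[ℝ] N) (h1 : f 1 = 0)
    (h : ∀ u v : List G.Letter, u ≠ [] → v ≠ [] →
      shSum G.deg u v (fun w => f (G.word w)) = 0) :
    Submodule.span ℝ {(1 : Tens V)} ⊔ G.shuffles ≤ LinearMap.ker f := by
  refine sup_le (Submodule.span_le.2 ?_) (Submodule.span_le.2 ?_)
  · rintro x rfl
    exact h1
  · rintro x ⟨u, v, hu, hv, rfl⟩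
    exact (shSum_map G.deg f u v G.word).trans (h u v hu hv)

/-- The part `⊗ⁿ V[1] / shuffles`. -/
def lenPart (n : ℕ) : Submodule ℝ G.CInf :=
  Submodule.span ℝ {x | ∃ w : List G.Letter, w.length = n ∧ x = G.cls (G.word w)}

/-- The part of (shifted) degree `i`. -/
def degPart (i : ℤ) : Submodule ℝ G.CInf :=
  Submodule.span ℝ {x | ∃ w : List G.Letter, wdeg G.deg w = i ∧ x = G.cls (G.word w)}

/-- The projection onto `⊗¹ V[1] = V[1]`. -/
def pr : G.CInf →ₗ[ℝ] V :=
  Submodule.liftQ _ prT (G.le_ker prT G.prT_nil (by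
    intro u v hu hv
    rw [shSum_congr G.deg u v _ (fun _ => 0), shSum_zero]
    intro w hw
    have hl := hw.length_eq
    rw [List.length_append] at hl
    have h1 := List.length_pos_iff.2 hu
    have h2 := List.length_pos_iff.2 hv
    match w, hl with
    | [], hl => simp at hl; omega
    | [a], hl => simp at hl; omega
    | a :: b :: w, _ => exact G.prT_cons_cons a b w))

/-- The cobracket on tensors, with values in the tensor square of the quotient. -/
def cobracketT : Tens V →ₗ[ℝ] G.CInf ⊗[ℝ] G.CInf :=
  TensorProduct.map G.cls G.cls ∘ₗ (LinearMap.id - G.flip) ∘ₗ decon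

theorem cobracketT_word (w : List G.Letter) :
    G.cobracketT (G.word w) = dSum w (fun u v => G.cls (G.word u) ⊗ₜ[ℝ] G.cls (G.word v) -
      ((-1 : ℝ) ^ (wdeg G.deg u * wdeg G.deg v)) •
        (G.cls (G.word v) ⊗ₜ[ℝ] G.cls (G.word u))) := by
  simp only [cobracketT, LinearMap.comp_apply, decon_word, dSum_map, LinearMap.sub_apply,
    LinearMap.id_apply, flip_word, map_sub, map_smul, TensorProduct.map_tmul]
  rw [dSum_sub]

theorem cobracketT_shSum (u v : List G.Letter) (hu : u ≠ []) (hv : v ≠ []) :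
    shSum G.deg u v (fun w => G.cobracketT (G.word w)) = 0 := by
  let φ : List G.Letter → G.CInf × G.CInf := fun w =>
    (G.cls (G.word w), ((-1 : ℝ) ^ wdeg G.deg w) • G.cls (G.word w))
  let β : G.CInf × G.CInf →ₗ[ℝ] G.CInf × G.CInf →ₗ[ℝ] G.CInf ⊗[ℝ] G.CInf :=
    LinearMap.mk₂ ℝ (fun x y => x.1 ⊗ₜ[ℝ] y.1 -
      (1 / 2 : ℝ) • (y.1 ⊗ₜ[ℝ] x.1 + y.1 ⊗ₜ[ℝ] x.2 + y.2 ⊗ₜ[ℝ] x.1 - y.2 ⊗ₜ[ℝ] x.2))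
      (by intros; simp only [Prod.fst_add, Prod.snd_add, TensorProduct.add_tmul,
            TensorProduct.tmul_add]; module)
      (by intros; simp only [Prod.smul_fst, Prod.smul_snd, TensorProduct.tmul_smul,
            ← TensorProduct.smul_tmul']; module)
      (by intros; simp only [Prod.fst_add, Prod.snd_add, TensorProduct.add_tmul,
            TensorProduct.tmul_add]; module)
      (by intros; simp only [Prod.smul_fst, Prod.smul_snd, TensorProduct.tmul_smul,
            ← TensorProduct.smul_tmul']; module)
  have hβ : ∀ x y : List G.Letter, β (φ x) (φ y) =
      G.cls (G.word x) ⊗ₜ[ℝ] G.cls (G.word y) -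
      ((-1 : ℝ) ^ (wdeg G.deg x * wdeg G.deg y)) •
        (G.cls (G.word y) ⊗ₜ[ℝ] G.cls (G.word x)) := by
    intro x y
    rw [← sgn_half]
    simp only [β, φ, LinearMap.mk₂_apply, TensorProduct.tmul_smul, ← TensorProduct.smul_tmul']
    module
  have h0 : φ [] = 0 := by
    have : G.cls (G.word []) = 0 := G.cls_one
    simp [φ, this]
  have hφ : ∀ u v, u ≠ [] → v ≠ [] → shSum G.deg u v φ = 0 := by
    intro u v hu hv
    have e := G.shSum_cls_word u v hu hv
    rw [shSum_congr G.deg u v φ (fun w => (LinearMap.prod (LinearMap.id : G.CInf →ₗ[ℝ] G.CInf)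
      (((-1 : ℝ) ^ wdeg G.deg (u ++ v)) • LinearMap.id)) (G.cls (G.word w))), ← shSum_map, e,
      map_zero]
    intro w hw
    have : wdeg G.deg w = wdeg G.deg (u ++ v) := (hw.map G.deg).sum_eq
    simp [φ, this]
  have key := shSum_dSum_bilin β φ h0 hφ u v hu hv
  simp only [hβ] at key
  simp only [cobracketT_word]
  rw [key, mul_comm (wdeg G.deg v)]
  have e : ((-1 : ℝ) ^ (wdeg G.deg u * wdeg G.deg v)) *
      ((-1 : ℝ) ^ (wdeg G.deg u * wdeg G.deg v)) = 1 := by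
    rw [← mul_zpow]; norm_num
  rw [smul_sub, smul_smul, e]
  module

/-- The Lie cobracket `δ`: on a word `a₁ ⋯ aₙ` it is the sum over `0 < j < n` of
`a₁⋯aⱼ ⊗ aⱼ₊₁⋯aₙ - (±1) aⱼ₊₁⋯aₙ ⊗ a₁⋯aⱼ` with the Koszul sign; the terms with an empty word,
which the deconcatenation also produces, are zero in the quotient. -/
def cobracket : G.CInf →ₗ[ℝ] G.CInf ⊗[ℝ] G.CInf :=
  Submodule.liftQ _ G.cobracketT (G.le_ker _ (by
    have h : G.cls 1 = 0 := G.cls_one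
    have := G.cobracketT_word []
    simpa [word, dSum, h] using this) G.cobracketT_shSum)

end Grading

end Tensor

/-! ### The codifferential `m` of `C_∞(R)` -/

namespace GradedCommAlg

variable {R : Type*} [AddCommGroup R] [Module ℝ R] (A : GradedCommAlg R)

/-- The product of homogeneous elements. -/
def mulLetter (a b : A.Letter) : A.Letter := ⟨a.1 + b.1, A.mul a.2 b.2, A.mul_mem a.2.2 b.2.2⟩

theorem deg_mulLetter (a b : A.Letter) :
    A.deg (A.mulLetter a b) = A.deg a + A.deg b + 1 := by
  simp [Grading.deg, mulLetter]; ring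

/-- The operation `m(a ⊗ b) = (-1)^{deg a} ab` from `R[1] ⊗ R[1]` to `R[1]`. -/
def mul2 : R ⊗[ℝ] R →ₗ[ℝ] R := TensorProduct.lift (A.mul ∘ₗ A.sign 1)

/-- `(a, a₁ ⊗ ⋯ ⊗ aₙ) ↦ m(a ⊗ a₁) ⊗ a₂ ⊗ ⋯ ⊗ aₙ`. -/
def headMul : R →ₗ[ℝ] Tens R →ₗ[ℝ] Tens R :=
  ((LinearMap.rTensorHom (Tens R) ∘ₗ A.mul ∘ₗ A.sign 1).compr₂ (TensorProduct.lift lmul)).compl₂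
    firstSplit

/-- The codifferential on tensors:
`m(a₀ ⊗ ⋯ ⊗ aₙ) = ∑ⱼ (-1)^{∑_{i<j} deg aᵢ} a₀ ⊗ ⋯ ⊗ m(aⱼ ⊗ aⱼ₊₁) ⊗ ⋯ ⊗ aₙ`. -/
def mT : Tens R →ₗ[ℝ] Tens R := tensRec A.headMul (lmul ∘ₗ A.sign 1) 0

theorem headMul_word (a : A.Letter) (w : List A.Letter) :
    A.headMul (a.2 : R) (A.word w) = headTerm A.deg A.mulLetter a A.word w := by
  cases w with
  | nil =>
    simp only [headMul, headTerm, LinearMap.compl₂_apply]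
    have : firstSplit (A.word []) = 0 := tensRec_one _ _ _
    rw [this, map_zero]
  | cons b w =>
    simp only [headMul, headTerm, LinearMap.compl₂_apply, A.firstSplit_cons,
      LinearMap.compr₂_apply, LinearMap.comp_apply, LinearMap.coe_rTensorHom,
      LinearMap.rTensor_tmul, TensorProduct.lift.tmul, lmul_apply, A.sign_apply, map_smul,
      LinearMap.smul_apply, one_mul]
    rfl

theorem mT_word (w : List A.Letter) : A.mT (A.word w) = mSum A.deg A.mulLetter w A.word := by
  induction w with
  | nil => exact tensRec_one _ _ _
  | cons a w ih =>
    rw [mSum_cons, Grading.word, mT, tensRec_mul, ← mT, ih, headMul_word]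
    simp only [LinearMap.comp_apply, A.sign_apply, map_smul, LinearMap.smul_apply, one_mul,
      mSum_map]
    rfl

theorem word_comm (p : List A.Letter) (a b : A.Letter) (w : List A.Letter) :
    A.word (p ++ A.mulLetter a b :: w) =
      ((-1 : ℝ) ^ ((A.deg a + 1) * (A.deg b + 1))) • A.word (p ++ A.mulLetter b a :: w) := by
  have h := A.mul_comm a.2.2 b.2.2
  simp only [Grading.word_append, Grading.word, mulLetter, Grading.deg, h, map_smul,
    smul_mul_assoc, mul_smul_comm, sub_add_cancel]

theorem merges_ne_nil {L : Type*} (mul : L → L → L) (l w : List L) (h : w ∈ merges mul l) :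
    w ≠ [] := by
  rintro rfl
  have := length_merges l [] h
  match l, this with
  | [a], _ => simp [merges] at h

/-- The codifferential `m` of the `C_∞` algebra of `R`. -/
def m : A.CInf →ₗ[ℝ] A.CInf :=
  Submodule.liftQ _ (A.cls ∘ₗ A.mT) (A.le_ker _
    (by
      have : A.mT 1 = 0 := tensRec_one _ _ _
      simp [this])
    (by
      intro u v hu hv
      simp only [LinearMap.comp_apply, A.mT_word]
      rw [← shSum_map, shSum_mSum A.deg_mulLetter u v A.word A.word_comm, map_add, map_smul]
      have h1 : A.cls (mSum A.deg A.mulLetter u fun u' => shSum A.deg u' v A.word) = 0 :=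
        LinearMap.mem_ker.1 (mSum_mem _ u _ fun w hw =>
          A.cls_shSum w v (merges_ne_nil _ u w hw) hv)
      have h2 : A.cls (mSum A.deg A.mulLetter v fun v' => shSum A.deg u v' A.word) = 0 :=
        LinearMap.mem_ker.1 (mSum_mem _ v _ fun w hw =>
          A.cls_shSum u w hu (merges_ne_nil _ v w hw))
      rw [h1, h2, smul_zero, add_zero]))

theorem m_cls_word (w : List A.Letter) :
    A.m (A.cls (A.word w)) = mSum A.deg A.mulLetter w (fun w' => A.cls (A.word w')) := by
  rw [← mSum_map, ← mT_word]
  rfl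

end GradedCommAlg

/-! ### The Harrison homology complex of a symmetric bimodule -/

namespace SymmBimodule

variable {R M : Type*} [AddCommGroup R] [Module ℝ R] [AddCommGroup M] [Module ℝ M]
  {A : GradedCommAlg R} (B : SymmBimodule A M)

/-- `m(a ⊗ v) = (-1)^{deg a} a.v`. -/
def lmul2 : R ⊗[ℝ] M →ₗ[ℝ] M := TensorProduct.lift (B.lact ∘ₗ A.sign 1)

/-- `m(v ⊗ a) = (-1)^{deg v} v.a`. -/
def rmul2 : M ⊗[ℝ] R →ₗ[ℝ] M := TensorProduct.lift (B.ract ∘ₗ B.sign 1)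

/-- The space `⨁_{j,k} ⊗ʲR[1] ⊗ M[1] ⊗ ⊗ᵏR[1]` of tensors with one factor in `M[1]`. -/
abbrev ChainT (_B : SymmBimodule A M) := Tens R ⊗[ℝ] (M ⊗[ℝ] Tens R)

/-- A homogeneous element of `R` or of `M`. -/
abbrev MLetter := A.Letter ⊕ B.Letter

/-- The shifted degree. -/
def mdeg : B.MLetter → ℤ := Sum.elim A.deg B.deg

/-- The products `ab`, `a.v`, `v.a`; the product of two elements of `M` is zero. -/
def mmul : B.MLetter → B.MLetter → B.MLetter
  | .inl a, .inl b => .inl (A.mulLetter a b)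
  | .inl a, .inr v => .inr ⟨a.1 + v.1, B.lact a.2 v.2, B.lact_mem a.2.2 v.2.2⟩
  | .inr v, .inl a => .inr ⟨v.1 + a.1, B.ract v.2 a.2, B.ract_mem a.2.2 v.2.2⟩
  | .inr u, .inr v => .inr ⟨u.1 + v.1, 0, Submodule.zero_mem _⟩

/-- The number of letters from `M`. -/
def numM (w : List B.MLetter) : ℕ := w.countP Sum.isRight

/-- The tensor of a word with letters in `R` (zero if there is a letter from `M`). -/
def pureWord : List B.MLetter → Tens R
  | [] => 1
  | .inl a :: w => TensorAlgebra.ι ℝ (a.2 : R) * pureWord w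
  | .inr _ :: _ => 0

/-- The tensor of a word with exactly one letter in `M` (zero for other words). -/
def mixedWord : List B.MLetter → B.ChainT
  | [] => 0
  | .inl a :: w => LinearMap.rTensor (M ⊗[ℝ] Tens R) (lmul (a.2 : R)) (mixedWord w)
  | .inr v :: w => 1 ⊗ₜ[ℝ] ((v.2 : M) ⊗ₜ[ℝ] pureWord B w)

/-- The span of the shuffles of two non-empty words with altogether one letter in `M`. -/
def mixedShuffles : Submodule ℝ B.ChainT :=
  Submodule.span ℝ {x | ∃ u v : List B.MLetter, u ≠ [] ∧ v ≠ [] ∧ B.numM u + B.numM v = 1 ∧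
    x = shSum B.mdeg u v B.mixedWord}

/-- The Harrison chains of `R` with values in `M`. -/
abbrev Chains := B.ChainT ⧸ B.mixedShuffles

/-- The class of a tensor. -/
def chainCls : B.ChainT →ₗ[ℝ] B.Chains := Submodule.mkQ B.mixedShuffles

/-- The chains with `n` tensor factors (one of them in `M[1]`). -/
def chainPart (n : ℕ) : Submodule ℝ B.Chains :=
  Submodule.span ℝ {x | ∃ w : List B.MLetter, B.numM w = 1 ∧ w.length = n ∧
    x = B.chainCls (B.mixedWord w)}

/-- The Hochschild boundary on tensors with one factor in `M[1]`. On
`a₀ ⊗ ⋯ ⊗ aᵢ₋₁ ⊗ v ⊗ aᵢ₊₁ ⊗ ⋯ ⊗ aₙ` the four summands are: the products of consecutive factors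
to the left of `v`; the product `m(aᵢ₋₁ ⊗ v)`; the product `m(v ⊗ aᵢ₊₁)`; the products of
consecutive factors to the right of `v`. -/
def boundaryT : B.ChainT →ₗ[ℝ] B.ChainT :=
  LinearMap.rTensor (M ⊗[ℝ] Tens R) A.mT
  + TensorProduct.map A.signT (LinearMap.rTensor (Tens R) B.lmul2)
      ∘ₗ LinearMap.lTensor (Tens R) (TensorProduct.assoc ℝ R M (Tens R)).symm.toLinearMap
      ∘ₗ (TensorProduct.assoc ℝ (Tens R) R (M ⊗[ℝ] Tens R)).toLinearMap
      ∘ₗ LinearMap.rTensor (M ⊗[ℝ] Tens R) lastSplit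
  + TensorProduct.map A.signT
      (LinearMap.rTensor (Tens R) B.rmul2
        ∘ₗ (TensorProduct.assoc ℝ M R (Tens R)).symm.toLinearMap
        ∘ₗ LinearMap.lTensor M firstSplit)
  + TensorProduct.map A.signT (TensorProduct.map (B.sign 1) A.mT)

theorem pureWord_inl (w : List A.Letter) : B.pureWord (w.map Sum.inl) = A.word w := by
  induction w with
  | nil => rfl
  | cons a w ih => simp [pureWord, Grading.word, ih]

theorem mixedWord_split (u w : List A.Letter) (v : B.Letter) :
    B.mixedWord (u.map Sum.inl ++ Sum.inr v :: w.map Sum.inl) =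
      A.word u ⊗ₜ ((v.2 : M) ⊗ₜ A.word w) := by
  induction u with
  | nil => simp [mixedWord, pureWord_inl, Grading.word]
  | cons a u ih => simp [mixedWord, Grading.word, ih]

theorem numM_inl (a : A.Letter) (w : List B.MLetter) : B.numM (Sum.inl a :: w) = B.numM w := by
  simp [numM]

theorem numM_inr (v : B.Letter) (w : List B.MLetter) :
    B.numM (Sum.inr v :: w) = B.numM w + 1 :=
  List.countP_cons_of_pos rfl

theorem exists_inl (w : List B.MLetter) (h : B.numM w = 0) :
    ∃ u : List A.Letter, w = u.map Sum.inl := by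
  induction w with
  | nil => exact ⟨[], rfl⟩
  | cons x w ih =>
    cases x with
    | inl a =>
      obtain ⟨u, rfl⟩ := ih (by simpa [numM_inl, numM_inr] using h)
      exact ⟨a :: u, rfl⟩
    | inr v => simp [numM] at h

theorem exists_split (w : List B.MLetter) (h : B.numM w = 1) :
    ∃ (u : List A.Letter) (v : B.Letter) (u' : List A.Letter),
      w = u.map Sum.inl ++ Sum.inr v :: u'.map Sum.inl := by
  induction w with
  | nil => simp [numM] at h
  | cons x w ih =>
    cases x with
    | inl a =>
      obtain ⟨u, v, u', rfl⟩ := ih (by simpa [numM_inl, numM_inr] using h)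
      exact ⟨a :: u, v, u', rfl⟩
    | inr v =>
      obtain ⟨u', rfl⟩ := B.exists_inl w (by simpa [numM_inl, numM_inr] using h)
      exact ⟨[], v, u', rfl⟩

theorem mSum_inl {N : Type*} [AddCommGroup N] [Module ℝ N] (w : List A.Letter)
    (Φ : List B.MLetter → N) :
    mSum B.mdeg B.mmul (w.map Sum.inl) Φ =
      mSum A.deg A.mulLetter w (fun w' => Φ (w'.map Sum.inl)) := by
  induction w generalizing Φ with
  | nil => rfl
  | cons a w ih =>
    cases w with
    | nil => rfl
    | cons b w =>
      have := ih (fun w' => Φ (Sum.inl a :: w'))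
      simp only [List.map_cons] at this ⊢
      simp only [mSum, this]
      rfl

theorem boundaryT_tmul (x y : Tens R) (v : M) :
    B.boundaryT (x ⊗ₜ (v ⊗ₜ y)) = A.mT x ⊗ₜ (v ⊗ₜ y)
      + TensorProduct.map A.signT (LinearMap.rTensor (Tens R) B.lmul2)
        (LinearMap.lTensor (Tens R) (TensorProduct.assoc ℝ R M (Tens R)).symm.toLinearMap
          (TensorProduct.assoc ℝ (Tens R) R (M ⊗[ℝ] Tens R) (lastSplit x ⊗ₜ (v ⊗ₜ y))))
      + A.signT x ⊗ₜ LinearMap.rTensor (Tens R) B.rmul2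
        ((TensorProduct.assoc ℝ M R (Tens R)).symm (v ⊗ₜ firstSplit y))
      + A.signT x ⊗ₜ (B.sign 1 v ⊗ₜ A.mT y) := by
  simp only [boundaryT, LinearMap.add_apply, LinearMap.comp_apply, LinearMap.rTensor_tmul,
    LinearMap.lTensor_tmul, TensorProduct.map_tmul, LinearEquiv.coe_coe]

theorem signT_mul (a : R) (x : Tens R) :
    A.signT (TensorAlgebra.ι ℝ a * x) = TensorAlgebra.ι ℝ (A.sign 1 a) * A.signT x := by
  simp [Grading.signT]

theorem mid_comm (a : R) (s : Tens R ⊗[ℝ] R) (v : M) (y : Tens R) :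
    TensorProduct.map A.signT (LinearMap.rTensor (Tens R) B.lmul2)
      (LinearMap.lTensor (Tens R) (TensorProduct.assoc ℝ R M (Tens R)).symm.toLinearMap
        (TensorProduct.assoc ℝ (Tens R) R (M ⊗[ℝ] Tens R)
          (LinearMap.rTensor R (lmul a) s ⊗ₜ (v ⊗ₜ y)))) =
    LinearMap.rTensor (M ⊗[ℝ] Tens R) (lmul (A.sign 1 a))
      (TensorProduct.map A.signT (LinearMap.rTensor (Tens R) B.lmul2)
      (LinearMap.lTensor (Tens R) (TensorProduct.assoc ℝ R M (Tens R)).symm.toLinearMap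
        (TensorProduct.assoc ℝ (Tens R) R (M ⊗[ℝ] Tens R) (s ⊗ₜ (v ⊗ₜ y))))) := by
  induction s using TensorProduct.induction_on with
  | zero => simp
  | add s t hs ht => simp only [map_add, TensorProduct.add_tmul, hs, ht]
  | tmul t r =>
    simp only [LinearMap.rTensor_tmul, TensorProduct.assoc_tmul, LinearMap.lTensor_tmul,
      LinearEquiv.coe_coe, TensorProduct.assoc_symm_tmul, TensorProduct.map_tmul, lmul_apply,
      signT_mul]

/-- The boundary is given by the products of consecutive letters. -/
theorem boundaryT_mixedWord (w : List B.MLetter) (h : B.numM w = 1) :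
    B.boundaryT (B.mixedWord w) = mSum B.mdeg B.mmul w B.mixedWord := by
  obtain ⟨u, v, u', rfl⟩ := B.exists_split w h
  clear h
  induction u with
  | nil =>
    have h1 : A.mT (A.word []) = 0 := tensRec_one _ _ _
    have h2 : lastSplit (A.word []) = 0 := A.lastSplit_nil
    have h3 : A.signT (A.word []) = 1 := by simp [Grading.signT, Grading.word]
    rw [mixedWord_split, boundaryT_tmul, h1, h2, h3, List.map_nil, List.nil_append, mSum_cons,
      mSum_inl]
    have e1 : mSum A.deg A.mulLetter u' (fun w' => B.mixedWord (Sum.inr v :: w'.map Sum.inl)) =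
        (1 : Tens R) ⊗ₜ ((v.2 : M) ⊗ₜ A.mT (A.word u')) := by
      rw [A.mT_word]
      simp only [mixedWord, pureWord_inl]
      exact (mSum_map (TensorProduct.mk ℝ _ _ (1 : Tens R) ∘ₗ
        TensorProduct.mk ℝ M (Tens R) (v.2 : M)) u' A.word).symm
    have e2 : headTerm B.mdeg B.mmul (Sum.inr v) B.mixedWord (u'.map Sum.inl) =
        (1 : Tens R) ⊗ₜ LinearMap.rTensor (Tens R) B.rmul2
        ((TensorProduct.assoc ℝ M R (Tens R)).symm ((v.2 : M) ⊗ₜ firstSplit (A.word u'))) := by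
      cases u' with
      | nil =>
        have : firstSplit (A.word []) = 0 := tensRec_one _ _ _
        simp [headTerm, this]
      | cons b u' =>
        rw [A.firstSplit_cons, TensorProduct.assoc_symm_tmul, LinearMap.rTensor_tmul]
        simp only [rmul2, TensorProduct.lift.tmul, LinearMap.comp_apply, B.sign_apply, one_mul,
          map_smul, LinearMap.smul_apply, List.map_cons, headTerm, mmul, mixedWord, pureWord_inl,
          TensorProduct.tmul_smul, ← TensorProduct.smul_tmul']
        rfl
    rw [e1, e2, B.sign_apply]
    simp only [TensorProduct.zero_tmul, map_zero, zero_add, one_mul, ← TensorProduct.smul_tmul',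
      TensorProduct.tmul_smul]
    rfl
  | cons a u ih =>
    have key : B.boundaryT (A.word (a :: u) ⊗ₜ ((v.2 : M) ⊗ₜ A.word u')) =
        headTerm B.mdeg B.mmul (Sum.inl a) B.mixedWord
          (u.map Sum.inl ++ Sum.inr v :: u'.map Sum.inl) +
        LinearMap.rTensor (M ⊗[ℝ] Tens R) (lmul (A.sign 1 (a.2 : R)))
          (B.boundaryT (A.word u ⊗ₜ ((v.2 : M) ⊗ₜ A.word u'))) := by
      have e1 : A.mT (A.word (a :: u)) = headTerm A.deg A.mulLetter a A.word u +
          lmul (A.sign 1 (a.2 : R)) (A.mT (A.word u)) := by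
        rw [← A.headMul_word, Grading.word, GradedCommAlg.mT, tensRec_mul]
        rfl
      have e2 : A.signT (A.word (a :: u)) =
          lmul (A.sign 1 (a.2 : R)) (A.signT (A.word u)) := by
        rw [Grading.word, signT_mul, lmul_apply]
      rw [boundaryT_tmul, boundaryT_tmul, e1, e2]
      cases u with
      | nil =>
        rw [A.lastSplit_singleton, A.lastSplit_nil]
        simp only [map_add, TensorProduct.add_tmul, LinearMap.rTensor_tmul,
          TensorProduct.zero_tmul, map_zero, TensorProduct.assoc_tmul, LinearMap.lTensor_tmul,
          LinearEquiv.coe_coe, TensorProduct.assoc_symm_tmul, TensorProduct.map_tmul, lmul2,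
          TensorProduct.lift.tmul, LinearMap.comp_apply, A.sign_apply, headTerm, List.map_nil,
          List.nil_append, mmul, mixedWord, pureWord_inl, map_smul, LinearMap.smul_apply,
          TensorProduct.tmul_smul, ← TensorProduct.smul_tmul', one_mul]
        have h3 : A.signT 1 = 1 := by simp [Grading.signT]
        rw [h3]
        have h4 : B.mdeg (Sum.inl a) = a.1 - 1 := rfl
        rw [h4]
        abel
      | cons b u =>
        rw [A.lastSplit_cons_cons, mid_comm]
        have e3 : headTerm A.deg A.mulLetter a A.word (b :: u) ⊗ₜ[ℝ]
            ((v.2 : M) ⊗ₜ[ℝ] A.word u') =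
            headTerm B.mdeg B.mmul (Sum.inl a) B.mixedWord
              ((b :: u).map Sum.inl ++ Sum.inr v :: u'.map Sum.inl) := by
          simp only [headTerm, List.map_cons, List.cons_append, mmul]
          have := B.mixedWord_split (A.mulLetter a b :: u) u' v
          rw [List.map_cons, List.cons_append] at this
          rw [this, ← TensorProduct.smul_tmul']
          rfl
        simp only [map_add, TensorProduct.add_tmul, LinearMap.rTensor_tmul, e3]
        abel
    rw [mixedWord_split] at ih ⊢
    rw [key, ih, List.map_cons, List.cons_append, mSum_cons, A.sign_apply, map_smul,
      LinearMap.rTensor_smul, LinearMap.smul_apply, mSum_map]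
    rw [one_mul]
    rfl

theorem mdeg_mmul (a b : B.MLetter) : B.mdeg (B.mmul a b) = B.mdeg a + B.mdeg b + 1 := by
  rcases a with a | a <;> rcases b with b | b <;>
    simp [mdeg, mmul, Grading.deg, GradedCommAlg.mulLetter] <;> ring

theorem numM_merges (l w : List B.MLetter) (hl : B.numM l ≤ 1) (h : w ∈ merges B.mmul l) :
    B.numM w = B.numM l := by
  induction l generalizing w with
  | nil => simp [merges] at h
  | cons a l ih =>
    cases l with
    | nil => simp [merges] at h
    | cons b l =>
      simp only [merges, List.mem_cons, List.mem_map] at h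
      rcases h with rfl | ⟨w', hw', rfl⟩
      · rcases a with a | a <;> rcases b with b | b <;>
          simp [mmul, numM_inl, numM_inr] at hl ⊢
      · rcases a with a | a
        · rw [numM_inl] at hl ⊢
          rw [ih w' hl hw', numM_inl]
        · rw [numM_inr] at hl ⊢
          rw [ih w' (by omega) hw', numM_inr]

theorem mixedWord_comm (p : List B.MLetter) (a b : B.MLetter) (w : List B.MLetter) :
    B.mixedWord (p ++ B.mmul a b :: w) =
      ((-1 : ℝ) ^ ((B.mdeg a + 1) * (B.mdeg b + 1))) • B.mixedWord (p ++ B.mmul b a :: w) := by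
  have hpure : ∀ p : List B.MLetter, B.pureWord (p ++ B.mmul a b :: w) =
      ((-1 : ℝ) ^ ((B.mdeg a + 1) * (B.mdeg b + 1))) • B.pureWord (p ++ B.mmul b a :: w) := by
    intro p
    induction p with
    | nil =>
      rcases a with a | a <;> rcases b with b | b <;>
        simp [mmul, pureWord, mdeg, Grading.deg, GradedCommAlg.mulLetter]
      rw [A.mul_comm a.2.2 b.2.2, map_smul, smul_mul_assoc]
    | cons c p ih =>
      rcases c with c | c
      · simp [pureWord, ih]
      · simp [pureWord]
  have sq : ∀ n : ℤ, (-1 : ℝ) ^ n * (-1 : ℝ) ^ n = 1 := fun n => by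
    rw [← mul_zpow]; norm_num
  induction p with
  | nil =>
    rcases a with a | a <;> rcases b with b | b
    · simp only [List.nil_append, mmul, mixedWord, mdeg, Sum.elim_inl, Grading.deg,
        GradedCommAlg.mulLetter, sub_add_cancel]
      rw [A.mul_comm a.2.2 b.2.2, map_smul, LinearMap.rTensor_smul, LinearMap.smul_apply]
    · simp only [List.nil_append, mmul, mixedWord, mdeg, Sum.elim_inl, Sum.elim_inr, Grading.deg,
        sub_add_cancel]
      rw [B.symm a.2.2 b.2.2]
      simp only [← TensorProduct.smul_tmul', TensorProduct.tmul_smul, smul_smul, sq, one_smul]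
    · simp only [List.nil_append, mmul, mixedWord, mdeg, Sum.elim_inl, Sum.elim_inr, Grading.deg,
        sub_add_cancel]
      rw [B.symm b.2.2 a.2.2, mul_comm b.1 a.1]
      simp only [← TensorProduct.smul_tmul', TensorProduct.tmul_smul]
    · simp [mmul, mixedWord]
  | cons c p ih =>
    rcases c with c | c
    · simp only [List.cons_append, mixedWord, ih, map_smul]
    · simp only [List.cons_append, mixedWord, hpure, TensorProduct.tmul_smul]

theorem numM_perm {u v : List B.MLetter} (h : u.Perm v) : B.numM u = B.numM v :=
  h.countP_eq _

theorem numM_append (u v : List B.MLetter) : B.numM (u ++ v) = B.numM u + B.numM v := by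
  simp [numM]

theorem chainCls_shSum (u v : List B.MLetter) (hu : u ≠ []) (hv : v ≠ [])
    (h : B.numM u + B.numM v = 1) : B.chainCls (shSum B.mdeg u v B.mixedWord) = 0 :=
  (Submodule.Quotient.mk_eq_zero _).2 (Submodule.subset_span ⟨u, v, hu, hv, h, rfl⟩)

/-- The boundary `∂` of the Harrison homology complex. -/
def boundary : B.Chains →ₗ[ℝ] B.Chains :=
  Submodule.liftQ _ (B.chainCls ∘ₗ B.boundaryT) (Submodule.span_le.2 (by
    rintro x ⟨u, v, hu, hv, h, rfl⟩
    change B.chainCls (B.boundaryT (shSum B.mdeg u v B.mixedWord)) = 0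
    rw [shSum_map, shSum_congr B.mdeg u v _ (fun w => mSum B.mdeg B.mmul w B.mixedWord)
      (fun w hw => B.boundaryT_mixedWord w (by rw [B.numM_perm hw, numM_append, h])),
      shSum_mSum B.mdeg_mmul u v B.mixedWord B.mixedWord_comm, map_add, map_smul]
    have h1 : B.chainCls
        (mSum B.mdeg B.mmul u fun u' => shSum B.mdeg u' v B.mixedWord) = 0 :=
      LinearMap.mem_ker.1 (mSum_mem _ u _ fun w hw =>
        B.chainCls_shSum w v (GradedCommAlg.merges_ne_nil _ u w hw) hv
          (by rw [B.numM_merges u w (by omega) hw, h]))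
    have h2 : B.chainCls
        (mSum B.mdeg B.mmul v fun v' => shSum B.mdeg u v' B.mixedWord) = 0 :=
      LinearMap.mem_ker.1 (mSum_mem _ v _ fun w hw =>
        B.chainCls_shSum u w hu (GradedCommAlg.merges_ne_nil _ v w hw)
          (by rw [B.numM_merges v w (by omega) hw, h]))
    rw [h1, h2, smul_zero, add_zero]))

/-- The map of tensor algebras induced by the inclusion of `R` in `R ⊕ M`. -/
def tensInl (R M : Type*) [AddCommGroup R] [Module ℝ R] [AddCommGroup M] [Module ℝ M] :
    Tens R →ₐ[ℝ] Tens (R × M) :=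
  TensorAlgebra.lift ℝ (TensorAlgebra.ι ℝ ∘ₗ LinearMap.inl ℝ R M)

/-- The canonical map to the tensors on `R ⋉ M`:
`x ⊗ v ⊗ y ↦ x ⊗ v ⊗ y`. -/
def inclT : B.ChainT →ₗ[ℝ] Tens (R × M) :=
  LinearMap.mul' ℝ (Tens (R × M)) ∘ₗ TensorProduct.map
    (tensInl R M).toLinearMap
    (LinearMap.mul' ℝ (Tens (R × M)) ∘ₗ TensorProduct.map
      (TensorAlgebra.ι ℝ ∘ₗ LinearMap.inr ℝ R M)
      (tensInl R M).toLinearMap)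

/-- A homogeneous element of `R` or `M` as a homogeneous element of `R ⋉ M`. -/
def inclLetter : B.MLetter → B.semidirect.Letter
  | .inl a => ⟨a.1, ((a.2 : R), 0), a.2.2, Submodule.zero_mem _⟩
  | .inr v => ⟨v.1, (0, (v.2 : M)), Submodule.zero_mem _, v.2.2⟩

theorem deg_inclLetter (a : B.MLetter) : B.semidirect.deg (B.inclLetter a) = B.mdeg a := by
  rcases a with a | a <;> rfl

theorem map_word (w : List A.Letter) :
    tensInl R M (A.word w) =
      B.semidirect.word ((w.map Sum.inl).map B.inclLetter) := by
  induction w with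
  | nil => simp [Grading.word]
  | cons a w ih =>
    rw [Grading.word, map_mul, ih]
    simp [Grading.word, inclLetter, tensInl]

theorem inclT_mixedWord (w : List B.MLetter) (h : B.numM w = 1) :
    B.inclT (B.mixedWord w) = B.semidirect.word (w.map B.inclLetter) := by
  obtain ⟨u, v, u', rfl⟩ := B.exists_split w h
  rw [mixedWord_split, List.map_append, List.map_cons, Grading.word_append, Grading.word,
    ← map_word, ← map_word]
  simp [inclT, inclLetter]

theorem shSum_mapLetter {L L' N : Type*} [AddCommGroup N] [Module ℝ N] (deg : L → ℤ)
    (deg' : L' → ℤ) (f : L → L') (hf : ∀ a, deg' (f a) = deg a) (u v : List L)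
    (Φ : List L' → N) :
    shSum deg' (u.map f) (v.map f) Φ = shSum deg u v (fun w => Φ (w.map f)) := by
  have hw : ∀ w : List L, wdeg deg' (w.map f) = wdeg deg w := by
    intro w
    simp [wdeg, Function.comp_def, hf]
  obtain ⟨n, hn⟩ : ∃ n, n = u.length + v.length := ⟨_, rfl⟩
  induction n using Nat.strong_induction_on generalizing u v Φ with
  | _ n ih =>
  cases u with
  | nil => simp [shSum_nil_left]
  | cons a u =>
  cases v with
  | nil => simp only [List.map_nil, shSum_nil_right]
  | cons b v =>
    have i1 := ih _ (by simp at hn; simp; omega) u (b :: v) (fun x => Φ (f a :: x)) rfl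
    have i2 := ih _ (by simp at hn; simp; omega) (a :: u) v (fun x => Φ (f b :: x)) rfl
    have e := hw (a :: u)
    rw [List.map_cons] at i1 i2 e
    rw [List.map_cons, List.map_cons, shSum_cons, shSum_cons, i1, i2, hf, e]
    rfl

/-- The canonical map from the Harrison chains of `M` to `C_∞(R ⋉ M)`. -/
def incl : B.Chains →ₗ[ℝ] B.semidirect.CInf :=
  Submodule.liftQ _ (B.semidirect.cls ∘ₗ B.inclT) (Submodule.span_le.2 (by
    rintro x ⟨u, v, hu, hv, h, rfl⟩
    change B.semidirect.cls (B.inclT (shSum B.mdeg u v B.mixedWord)) = 0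
    rw [shSum_map, shSum_congr B.mdeg u v _
      (fun w => B.semidirect.word (w.map B.inclLetter))
      (fun w hw => B.inclT_mixedWord w (by rw [B.numM_perm hw, numM_append, h])),
      ← shSum_mapLetter B.mdeg B.semidirect.deg B.inclLetter B.deg_inclLetter]
    exact B.semidirect.cls_shSum _ _ (by simpa using hu) (by simpa using hv)))

end SymmBimodule

/-! ### Harrison cochains, morphisms, trivial morphisms -/

namespace SymmBimodule

variable {R M : Type*} [AddCommGroup R] [Module ℝ R] [AddCommGroup M] [Module ℝ M]
  {A : GradedCommAlg R} (B : SymmBimodule A M)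

/-- The linear map `f` from `⨁ₙ ⊗ⁿR[1] / shuffles` to `M[1]` is homogeneous of degree `d`. -/
def IsHomog (d : ℤ) (f : A.CInf →ₗ[ℝ] M) : Prop :=
  ∀ (i : ℤ), ∀ x ∈ A.degPart i, f x ∈ B.gr (i + d + 1)

/-- The cochains of degree `d` in `Cⁿ(R, M) = L(⊗ⁿR[1] / shuffles, M[1])`; a linear map on
`⊗ⁿR[1] / shuffles` is extended by zero to the other summands of `⨁ₖ ⊗ᵏR[1] / shuffles`. -/
def Cochain (n : ℕ) (d : ℤ) : Submodule ℝ (A.CInf →ₗ[ℝ] M) where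
  carrier := {f | (∀ k, k ≠ n → ∀ x ∈ A.lenPart k, f x = 0) ∧ B.IsHomog d f}
  add_mem' := by
    rintro f g ⟨hf, hf'⟩ ⟨hg, hg'⟩
    exact ⟨fun k hk x hx => by simp [hf k hk x hx, hg k hk x hx],
      fun i x hx => Submodule.add_mem _ (hf' i x hx) (hg' i x hx)⟩
  zero_mem' := ⟨fun _ _ _ _ => rfl, fun _ _ _ => Submodule.zero_mem _⟩
  smul_mem' := by
    rintro c f ⟨hf, hf'⟩
    exact ⟨fun k hk x hx => by simp [hf k hk x hx],
      fun i x hx => Submodule.smul_mem _ _ (hf' i x hx)⟩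

/-- The coboundary of a linear map of degree `d`, as a map on tensors. -/
def coboundaryT (d : ℤ) (f : A.CInf →ₗ[ℝ] M) : Tens R →ₗ[ℝ] M :=
  B.lmul2 ∘ₗ TensorProduct.map (A.sign d ∘ₗ prT) (f ∘ₗ A.cls) ∘ₗ decon
  + B.rmul2 ∘ₗ TensorProduct.map (f ∘ₗ A.cls) prT ∘ₗ decon
  - ((-1 : ℝ) ^ d) • (f ∘ₗ A.cls ∘ₗ A.mT)

theorem cls_word_mem (w : List A.Letter) : A.cls (A.word w) ∈ A.degPart (wdeg A.deg w) :=
  Submodule.subset_span ⟨w, rfl, rfl⟩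

theorem prT_mem (w : List A.Letter) : prT (A.word w) ∈ A.gr (wdeg A.deg w + 1) := by
  match w with
  | [] => rw [A.prT_nil]; exact Submodule.zero_mem _
  | [a] =>
    rw [A.prT_singleton]
    have : wdeg A.deg [a] + 1 = a.1 := by simp [Grading.deg]
    rw [this]
    exact a.2.2
  | a :: b :: w => rw [A.prT_cons_cons]; exact Submodule.zero_mem _

theorem sign_mem {V : Type*} [AddCommGroup V] [Module ℝ V] (G : Grading V) (d : ℤ) {i : ℤ}
    {v : V} (hv : v ∈ G.gr i) : G.sign d v = ((-1 : ℝ) ^ (d * (i - 1))) • v :=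
  G.sign_apply d ⟨v, hv⟩

theorem pr_cls (x : Tens R) : A.pr (A.cls x) = prT x := rfl

theorem coboundaryT_word (d : ℤ) (f : A.CInf →ₗ[ℝ] M) (w : List A.Letter) :
    B.coboundaryT d f (A.word w) =
      dSum w (fun u v => B.lmul2 (A.sign d (A.pr (A.cls (A.word u))) ⊗ₜ f (A.cls (A.word v))) +
        B.rmul2 (f (A.cls (A.word u)) ⊗ₜ A.pr (A.cls (A.word v)))) -
      ((-1 : ℝ) ^ d) • f (A.m (A.cls (A.word w))) := by
  simp only [coboundaryT, LinearMap.sub_apply, LinearMap.add_apply, LinearMap.comp_apply,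
    A.decon_word, dSum_map, TensorProduct.map_tmul, dSum_add, pr_cls, LinearMap.smul_apply]
  rfl

theorem coboundaryT_shSum (d : ℤ) (f : A.CInf →ₗ[ℝ] M) (hf : B.IsHomog d f)
    (u v : List A.Letter) (hu : u ≠ []) (hv : v ≠ []) :
    shSum A.deg u v (fun w => B.coboundaryT d f (A.word w)) = 0 := by
  let β : A.CInf →ₗ[ℝ] A.CInf →ₗ[ℝ] M :=
    (TensorProduct.mk ℝ A.CInf A.CInf).compr₂
      (B.lmul2 ∘ₗ TensorProduct.map (A.sign d ∘ₗ A.pr) f + B.rmul2 ∘ₗ TensorProduct.map f A.pr)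
  have hβ : ∀ x y : List A.Letter, β (A.cls (A.word x)) (A.cls (A.word y)) =
      B.lmul2 (A.sign d (A.pr (A.cls (A.word x))) ⊗ₜ f (A.cls (A.word y))) +
        B.rmul2 (f (A.cls (A.word x)) ⊗ₜ A.pr (A.cls (A.word y))) := fun x y => rfl
  have key := shSum_dSum_bilin (deg := A.deg) β (fun w => A.cls (A.word w)) A.cls_one
    A.shSum_cls_word u v hu hv
  simp only [hβ] at key
  simp only [coboundaryT_word, sub_eq_add_neg, ← neg_smul]
  rw [shSum_add, key, shSum_smul, ← shSum_map, ← shSum_map, A.shSum_cls_word u v hu hv]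
  have e : ∀ x y : List A.Letter,
      B.rmul2 (f (A.cls (A.word x)) ⊗ₜ A.pr (A.cls (A.word y))) =
      -(((-1 : ℝ) ^ (wdeg A.deg x * wdeg A.deg y)) •
        B.lmul2 (A.sign d (A.pr (A.cls (A.word y))) ⊗ₜ f (A.cls (A.word x)))) := by
    intro x y
    have h1 := hf _ _ (cls_word_mem x)
    have h2 := prT_mem y
    rw [← pr_cls] at h2
    simp only [rmul2, lmul2, TensorProduct.lift.tmul, LinearMap.comp_apply]
    rw [sign_mem B.toGrading 1 h1, sign_mem A.toGrading d h2, map_smul, map_smul,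
      sign_mem A.toGrading 1 h2]
    simp only [map_smul, LinearMap.smul_apply, smul_smul]
    rw [B.symm h2 h1, smul_smul, sgn_mul, sgn_mul, sgn_mul, ← neg_smul]
    congr 1
    refine sgn_eq_neg ?_
    generalize wdeg A.deg x = p
    generalize wdeg A.deg y = q
    exact ⟨p + d, by ring⟩
  have sq : ∀ n : ℤ, (-1 : ℝ) ^ n * (-1 : ℝ) ^ n = 1 := fun n => by
    rw [← mul_zpow]; norm_num
  rw [e u v, e v u, mul_comm (wdeg A.deg v), smul_add, smul_neg, smul_smul, sq]
  simp

/-- The coboundary of a linear map `f` of degree `d`. -/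
def coboundaryMap (d : ℤ) (f : A.CInf →ₗ[ℝ] M) (hf : B.IsHomog d f) : A.CInf →ₗ[ℝ] M :=
  Submodule.liftQ _ (B.coboundaryT d f) (A.le_ker _ (by
    have := B.coboundaryT_word d f []
    have h : A.cls 1 = 0 := A.cls_one
    simpa [Grading.word, dSum, h] using this) (B.coboundaryT_shSum d f hf))

theorem coboundaryMap_cls (d : ℤ) (f : A.CInf →ₗ[ℝ] M) (hf : B.IsHomog d f) (x : Tens R) :
    B.coboundaryMap d f hf (A.cls x) = B.coboundaryT d f x := rfl

/-- The explicit formula for the coboundary. -/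
theorem coboundaryMap_word (d : ℤ) (f : A.CInf →ₗ[ℝ] M) (hf : B.IsHomog d f)
    (a b : A.Letter) (w : List A.Letter) :
    B.coboundaryMap d f hf (A.cls (A.word (a :: (w ++ [b])))) =
      ((-1 : ℝ) ^ (d * A.deg a)) • B.lmul2 ((a.2 : R) ⊗ₜ f (A.cls (A.word (w ++ [b])))) -
      ((-1 : ℝ) ^ d) • mSum A.deg A.mulLetter (a :: (w ++ [b])) (fun w' => f (A.cls (A.word w'))) +
      B.rmul2 (f (A.cls (A.word (a :: w))) ⊗ₜ (b.2 : R)) := by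
  have h0 : A.cls (A.word []) = 0 := A.cls_one
  rw [coboundaryMap_cls, coboundaryT_word, A.m_cls_word, mSum_map, dSum_add]
  have e1 : dSum (a :: (w ++ [b])) (fun u v =>
      B.lmul2 (A.sign d (A.pr (A.cls (A.word u))) ⊗ₜ f (A.cls (A.word v)))) =
      ((-1 : ℝ) ^ (d * A.deg a)) • B.lmul2 ((a.2 : R) ⊗ₜ f (A.cls (A.word (w ++ [b])))) := by
    have aux : ∀ (c : A.Letter) (l : List A.Letter),
        dSum (c :: l) (fun u v => B.lmul2 (A.sign d (A.pr (A.cls (A.word (a :: u)))) ⊗ₜ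
          f (A.cls (A.word v)))) =
        ((-1 : ℝ) ^ (d * A.deg a)) • B.lmul2 ((a.2 : R) ⊗ₜ f (A.cls (A.word (c :: l)))) := by
      intro c l
      rw [dSum, dSum_congr l _ (fun _ _ => 0), dSum_zero, add_zero, pr_cls, A.prT_singleton,
        A.sign_apply, ← TensorProduct.smul_tmul', map_smul]
      · rfl
      · intro u v _
        rw [pr_cls, A.prT_cons_cons]
        simp
    rw [dSum, h0, map_zero, map_zero, TensorProduct.zero_tmul, map_zero, zero_add]
    match w with
    | [] => exact aux b []
    | c :: w => exact aux c (w ++ [b])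
  have e2 : dSum (a :: (w ++ [b])) (fun u v =>
      B.rmul2 (f (A.cls (A.word u)) ⊗ₜ A.pr (A.cls (A.word v)))) =
      B.rmul2 (f (A.cls (A.word (a :: w))) ⊗ₜ (b.2 : R)) := by
    have aux : ∀ (l : List A.Letter) (p : List A.Letter),
        dSum (l ++ [b]) (fun u v => B.rmul2 (f (A.cls (A.word (p ++ u))) ⊗ₜ
          A.pr (A.cls (A.word v)))) =
        B.rmul2 (f (A.cls (A.word (p ++ l))) ⊗ₜ (b.2 : R)) := by
      intro l
      induction l with
      | nil =>
        intro p
        simp [dSum, pr_cls, A.prT_nil, A.prT_singleton]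
      | cons c l ih =>
        intro p
        have := ih (p ++ [c])
        simp only [List.append_assoc, List.singleton_append] at this
        rw [List.cons_append, dSum, this]
        have hz : A.pr (A.cls (A.word (c :: (l ++ [b])))) = 0 := by
          rw [pr_cls]
          cases l with
          | nil => exact A.prT_cons_cons _ _ _
          | cons d l => exact A.prT_cons_cons _ _ _
        rw [hz, TensorProduct.tmul_zero, map_zero, zero_add]
    exact aux (a :: w) []
  rw [e1, e2]
  abel

/-- The Harrison coboundary `∂ : Cⁿ(R, M) → Cⁿ⁺¹(R, M)`. For `f` homogeneous of degree `d`,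
`(∂f)(a₀ ⋯ aₙ) = (-1)^{d deg a₀} m(a₀ ⊗ f(a₁ ⋯ aₙ))
  - (-1)^d ∑ⱼ (-1)^{∑_{k<j} deg aₖ} f(a₀ ⋯ m(aⱼ ⊗ aⱼ₊₁) ⋯ aₙ) + m(f(a₀ ⋯ aₙ₋₁) ⊗ aₙ)`. -/
def coboundary {n : ℕ} {d : ℤ} (f : B.Cochain n d) : B.Cochain (n + 1) (d + 1) :=
  ⟨B.coboundaryMap d f f.2.2, by
    constructor
    · intro k hk x hx
      refine Submodule.span_induction (p := fun x _ => B.coboundaryMap d f f.2.2 x = 0)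
        ?_ (map_zero _) (fun x y _ _ hx hy => by rw [map_add, hx, hy, add_zero])
        (fun c x _ hx => by rw [map_smul, hx, smul_zero]) hx
      rintro x ⟨w, hw, rfl⟩
      have hf : ∀ w' : List A.Letter, w'.length ≠ n → f.1 (A.cls (A.word w')) = 0 :=
        fun w' hw' => f.2.1 _ hw' _ (Submodule.subset_span ⟨w', rfl, rfl⟩)
      have hz : ∀ l : List A.Letter, l.length ≠ n + 1 →
          mSum A.deg A.mulLetter l (fun w' => f.1 (A.cls (A.word w'))) = 0 := fun l hl =>
        (Submodule.mem_bot ℝ).1 (mSum_mem ⊥ l _ fun w' hw' => (Submodule.mem_bot ℝ).2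
          (hf w' (by have := length_merges l w' hw'; omega)))
      match w, hw with
      | [], _ =>
        have : A.cls (A.word []) = 0 := A.cls_one
        rw [this, map_zero]
      | [a], _ =>
        have h0 : A.cls (A.word []) = 0 := A.cls_one
        rw [coboundaryMap_cls, coboundaryT_word, A.m_cls_word]
        simp [dSum, mSum, h0]
      | a :: b :: w, hw =>
        obtain ⟨l, c, hl⟩ : ∃ l c, b :: w = l ++ [c] :=
          ⟨_, _, (List.dropLast_append_getLast (List.cons_ne_nil b w)).symm⟩
        rw [hl] at hw ⊢
        simp at hw
        rw [coboundaryMap_word, hf _ (by simp; omega), hf _ (by simp; omega),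
          hz _ (by simp; omega)]
        simp
    · intro i x hx
      refine Submodule.span_induction
        (p := fun x _ => B.coboundaryMap d f f.2.2 x ∈ B.gr (i + (d + 1) + 1))
        ?_ (by rw [map_zero]; exact Submodule.zero_mem _)
        (fun x y _ _ hx hy => by rw [map_add]; exact Submodule.add_mem _ hx hy)
        (fun c x _ hx => by rw [map_smul]; exact Submodule.smul_mem _ _ hx) hx
      rintro x ⟨w, rfl, rfl⟩
      have hf : ∀ w' : List A.Letter, f.1 (A.cls (A.word w')) ∈
          B.gr (wdeg A.deg w' + d + 1) := fun w' => f.2.2 _ _ (cls_word_mem w')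
      match w with
      | [] =>
        have : A.cls (A.word []) = 0 := A.cls_one
        rw [this, map_zero]
        exact Submodule.zero_mem _
      | [a] =>
        have h0 : A.cls (A.word []) = 0 := A.cls_one
        rw [coboundaryMap_cls, coboundaryT_word, A.m_cls_word]
        simp [dSum, mSum, h0]
      | a :: b :: w =>
        obtain ⟨l, c, hl⟩ : ∃ l c, b :: w = l ++ [c] :=
          ⟨_, _, (List.dropLast_append_getLast (List.cons_ne_nil b w)).symm⟩
        rw [hl, coboundaryMap_word]
        have ha := A.sign_apply 1 a.2
        have hx1 := hf (l ++ [c])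
        have hx2 := hf (a :: l)
        refine Submodule.add_mem _ (Submodule.sub_mem _ (Submodule.smul_mem _ _ ?_)
          (Submodule.smul_mem _ _ ?_)) ?_
        · simp only [lmul2, TensorProduct.lift.tmul, LinearMap.comp_apply, ha, map_smul,
            LinearMap.smul_apply]
          refine Submodule.smul_mem _ _ ?_
          have := B.lact_mem a.2.2 hx1
          convert this using 2
          simp [Grading.deg]
          ring
        · refine mSum_mem _ _ _ fun w' hw' => ?_
          have := hf w'
          rw [wdeg_merges A.deg_mulLetter _ w' hw'] at this
          convert this using 2
          ring
        · simp only [rmul2, TensorProduct.lift.tmul, LinearMap.comp_apply,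
            sign_mem B.toGrading 1 hx2, map_smul, LinearMap.smul_apply]
          refine Submodule.smul_mem _ _ ?_
          have := B.ract_mem c.2.2 hx2
          convert this using 2
          simp [Grading.deg]
          ring⟩

end SymmBimodule

/-- A morphism of Lie coalgebras of degree `0`: `(F ⊗ F) ∘ δ = δ ∘ F`. -/
structure IsLieCoalgHom {V W : Type*} [AddCommGroup V] [Module ℝ V] [AddCommGroup W] [Module ℝ W]
    (G : Grading V) (H : Grading W) (F : G.CInf →ₗ[ℝ] H.CInf) : Prop where
  cobracket_comp : TensorProduct.map F F ∘ₗ G.cobracket = H.cobracket ∘ₗ F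
  deg_zero : ∀ (i : ℤ), ∀ x ∈ G.degPart i, F x ∈ H.degPart i

namespace SymmBimodule

variable {R M : Type*} [AddCommGroup R] [Module ℝ R] [AddCommGroup M] [Module ℝ M]
  {A : GradedCommAlg R} (B : SymmBimodule A M)

/-- The Taylor coefficients of `F` are `F₁ = ι + c₁` and `Fₙ = cₙ` for `n ≥ 2`. -/
def HasTaylor (F : A.CInf →ₗ[ℝ] B.semidirect.CInf) (c : ∀ n, B.Cochain n 0) : Prop :=
  (∀ x ∈ A.lenPart 1, B.semidirect.pr (F x) =
    LinearMap.inl ℝ R M (A.pr x) + LinearMap.inr ℝ R M ((c 1).1 x)) ∧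
  ∀ n, 2 ≤ n → ∀ x ∈ A.lenPart n,
    B.semidirect.pr (F x) = LinearMap.inr ℝ R M ((c n).1 x)

/-- `F` is trivial: there is a linear map `b` of degree `-1` (that is, a sequence of maps `bₙ`
from `⊗ⁿR[1] / shuffles` to `M[1]`) with
`c = m_S ∘ (ι ⊗ b + b ⊗ ι) + b ∘ m_R`, where `ι + c` is the projection of `F` on `S[1]`. The maps
`ι ⊗ b` and `b ⊗ ι` are applied to the deconcatenation, and obey the Koszul rule:
`(ι ⊗ b)(a ⊗ x) = (-1)^{- deg a} ι(a) ⊗ b(x)`. -/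
def IsTrivial (F : A.CInf →ₗ[ℝ] B.semidirect.CInf) : Prop :=
  ∃ b : A.CInf →ₗ[ℝ] M, B.IsHomog (-1) b ∧ ∀ x : Tens R,
    B.semidirect.pr (F (A.cls x)) =
      LinearMap.inl ℝ R M (prT x) +
      (B.semidirect.mul2
        (TensorProduct.map (LinearMap.inl ℝ R M ∘ₗ A.sign (-1) ∘ₗ prT)
            (LinearMap.inr ℝ R M ∘ₗ b ∘ₗ A.cls) (decon x) +
          TensorProduct.map (LinearMap.inr ℝ R M ∘ₗ b ∘ₗ A.cls)
            (LinearMap.inl ℝ R M ∘ₗ prT) (decon x)) +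
      LinearMap.inr ℝ R M (b (A.m (A.cls x))))

end SymmBimodule

end Harrison

end

namespace Harrison

/-! ### The codifferential squares to zero -/

section Words

variable {L N : Type*} [AddCommGroup N] [Module ℝ N] {deg : L → ℤ} {mul : L → L → L}

/-! Words in homogeneous letters span the tensors, so linear identities on the quotients by shuffles
are checked on words.

Subcomplex. In `m²`, disjoint products cancel because `m` has degree one, and overlapping products
cancel by associativity and the same sign. The canonical map commutes with the differentials letter
by letter; the real point is its injectivity, since the letters of a shuffle in `S` may have
components in both `R` and `M`. Expanding every letter into its two components, which have the same
degree and hence produce the same Koszul signs, turns such a shuffle into a sum of shuffles of words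
with letters in `R` or `M`. Keeping the words with exactly one letter in `M` therefore descends to a
left inverse `proj` of `incl`. Then `∂² = 0` is inherited from `m² = 0`.

Morphisms. The kernel of the Lie cobracket consists of the tensors with one factor
(`eq_zero_of_cobracket_eq_zero`): iterating the cobracket down to letters gives the adjoint Dynkin
operator, which modulo shuffles is multiplication by `n` on tensors with `n` factors
(`dynSum_nil_left`), and `n` is invertible over the reals. Hence a coderivation along `F` vanishes
as soon as its projection to one factor does (`eq_zero_of_coderivation`). The codifferential is a
coderivation, so `m_S F - F m_R` is one along `F`, and only its projection matters. Now `pr ∘ m` is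
half the product applied to the cobracket, so `pr m_S F` depends only on `pr F = ι + c`. As `M · M =
0`, no term quadratic in `c` appears, and the projection of `m_S F - F m_R` is exactly `∂c`
(`HasTaylor.pr_m`). Since `∂` raises the number of factors by one and vanishes on one factor, `∂c =
0` splits into `∂c_j = 0` for `j ≥ 1`.

Trivial morphisms. For `deg b = -1` the sign `-(-1)^{deg b}` is `+1`, so the defining equation reads
`c = ∂b`. Sorting by the number of factors gives `c_1 = 0` and `c_{n+1} = ∂b_n`; conversely `glue`
assembles the `b_n` into one map. -/

theorem sgn_mul_self (n : ℤ) : (-1 : ℝ) ^ n * (-1 : ℝ) ^ n = 1 := by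
  rw [← mul_zpow]; norm_num

/-- Split off the first letter `a`. The terms that leave `a` alone vanish by induction. Those that
multiply `a` cancel in pairs: `(ab)c` against `a(bc)` by associativity, and the product `ab` against
a product further right by the sign `(-1)^{deg(ab)} = -(-1)^{deg a + deg b}`. -/
theorem mSum_mSum (hd : ∀ a b, deg (mul a b) = deg a + deg b + 1)
    (ha : ∀ a b c, mul (mul a b) c = mul a (mul b c)) (l : List L) (Φ : List L → N) :
    mSum deg mul l (fun w => mSum deg mul w Φ) = 0 := by
  induction l generalizing Φ with
  | nil => rfl
  | cons a l ih =>
    have key : headTerm deg mul a (fun w => mSum deg mul w Φ) l +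
        ((-1 : ℝ) ^ deg a) • mSum deg mul l (headTerm deg mul a Φ) = 0 := by
      match l with
      | [] => simp [headTerm, mSum]
      | [b] => simp [headTerm, mSum]
      | b :: c :: w =>
        have e : (-1 : ℝ) ^ deg (mul a b) = -((-1 : ℝ) ^ deg a * (-1 : ℝ) ^ deg b) := by
          rw [hd, sgn_mul]
          exact sgn_eq_neg ⟨0, by ring⟩
        simp only [headTerm, mSum, mSum_smul, ha, e]
        module
    rw [mSum_cons]
    simp only [mSum_cons a]
    rw [mSum_add, mSum_smul, ih, smul_zero, add_zero, key]

theorem mSum_mapLetter {L' : Type*} {deg' : L' → ℤ} {mul' : L' → L' → L'} (f : L → L')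
    (hf : ∀ a, deg' (f a) = deg a) (hm : ∀ a b, f (mul a b) = mul' (f a) (f b)) (l : List L)
    (Φ : List L' → N) :
    mSum deg' mul' (l.map f) Φ = mSum deg mul l (fun w => Φ (w.map f)) := by
  induction l generalizing Φ with
  | nil => rfl
  | cons a l ih =>
    cases l with
    | nil => rfl
    | cons b l =>
      have := ih (fun w => Φ (f a :: w))
      rw [List.map_cons] at this
      simp only [List.map_cons, mSum, hf, hm, this]

/-! ### Shuffles sorted by the last letter, and the dual Dynkin operator -/

/-- The defining recursion of `shSum` peels off first letters; this is its mirror image. If `a`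
comes last, it has moved past the whole right word, whence the sign. The induction peels a first
letter on both sides. -/
theorem shSum_concat (a b : L) (u v : List L) (Φ : List L → N) :
    shSum deg (u ++ [a]) (v ++ [b]) Φ =
      ((-1 : ℝ) ^ (deg a * wdeg deg (v ++ [b]))) •
        shSum deg u (v ++ [b]) (fun w => Φ (w ++ [a])) +
      shSum deg (u ++ [a]) v (fun w => Φ (w ++ [b])) := by
  obtain ⟨n, hn⟩ : ∃ n, n = u.length + v.length := ⟨_, rfl⟩
  induction n using Nat.strong_induction_on generalizing u v Φ with
  | _ n ih =>
  cases u with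
  | nil =>
    cases v with
    | nil =>
      simp only [List.nil_append, shSum_cons, shSum_nil_left, shSum_nil_right, wdeg_cons,
        wdeg_nil, add_zero, List.cons_append, mul_comm (deg b)]
      abel
    | cons d v =>
      have i2 := ih _ (by simp at hn; simp; omega) [] v (fun x => Φ (d :: x)) rfl
      simp only [List.nil_append, List.cons_append, shSum_nil_left] at i2 ⊢
      rw [shSum_cons, shSum_cons, i2]
      simp only [shSum_nil_left, smul_add, smul_smul, sgn_mul, wdeg_cons, wdeg_nil, add_zero,
        wdeg_append, List.cons_append]
      rw [show deg d * deg a + deg a * (wdeg deg v + deg b) =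
        deg a * (deg d + (wdeg deg v + deg b)) by ring]
      abel
  | cons c u =>
    cases v with
    | nil =>
      have i1 := ih _ (by simp at hn; simp; omega) u [] (fun x => Φ (c :: x)) rfl
      simp only [List.nil_append, List.cons_append, shSum_nil_right] at i1 ⊢
      rw [shSum_cons, shSum_cons, i1]
      simp only [shSum_nil_right, smul_add, smul_smul, sgn_mul, wdeg_cons, wdeg_nil, add_zero,
        wdeg_append, List.cons_append]
      rw [show deg b * (deg c + (wdeg deg u + deg a)) =
        deg a * deg b + deg b * (deg c + wdeg deg u) by ring]
      abel
    | cons d v =>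
      have i1 := ih _ (by simp at hn; simp; omega) u (d :: v) (fun x => Φ (c :: x)) rfl
      have i2 := ih _ (by simp at hn; simp; omega) (c :: u) v (fun x => Φ (d :: x)) rfl
      simp only [List.cons_append] at i1 i2 ⊢
      rw [shSum_cons, i1, i2, shSum_cons, shSum_cons deg c d (u ++ [a])]
      -- The letter `d` goes to the front and `a` to the end; their mutual crossing is counted with
      -- either of the two moves.
      have e : (-1 : ℝ) ^ (deg d * wdeg deg (c :: (u ++ [a]))) *
          (-1 : ℝ) ^ (deg a * wdeg deg (v ++ [b])) =
          (-1 : ℝ) ^ (deg a * wdeg deg (d :: (v ++ [b]))) *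
          (-1 : ℝ) ^ (deg d * wdeg deg (c :: u)) := by
        rw [sgn_mul, sgn_mul]
        congr 1
        simp
        ring
      simp only [smul_add, smul_smul, e]
      simp only [List.cons_append]
      abel

/-- The signed sum of `(-1)^{|p|} Φ(c (p̃ r ⧢ q))` over all decompositions `w = p c q`, where `p̃`
is the reversal of `p`. For `r` empty this is the adjoint of the Dynkin operator. -/
noncomputable def dynSum (deg : L → ℤ) : List L → List L → (List L → N) → N
  | _, [], _ => 0
  | r, c :: v, Φ => ((-1 : ℝ) ^ (deg c * wdeg deg r)) •
      (shSum deg r v (fun w => Φ (c :: w)) - dynSum deg (c :: r) v Φ)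

/-- The signed sum of `(-1)^{|p|} |q| Φ(p̃ r ⧢ q)` over all decompositions `w = p q`, where `p̃` is
the reversal of `p`. -/
noncomputable def lenSum (deg : L → ℤ) : List L → List L → (List L → N) → N
  | _, [], _ => 0
  | r, c :: v, Φ => ((v.length : ℝ) + 1) • shSum deg r (c :: v) Φ -
      ((-1 : ℝ) ^ (deg c * wdeg deg r)) • lenSum deg (c :: r) v Φ

/-- A telescoping sum: expand each shuffle in `lenSum` by its first letter. The words starting with
`c` get weight `|v| + 1` from one term and `-|v|` from the next, up to the common sign, and the
remaining weight one is the summand of `dynSum`. -/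
theorem lenSum_cons_left (d : L) (r w : List L) (Φ : List L → N) :
    lenSum deg (d :: r) w Φ =
      (w.length : ℝ) • shSum deg r w (fun x => Φ (d :: x)) + dynSum deg (d :: r) w Φ := by
  induction w generalizing d r with
  | nil => simp [lenSum, dynSum]
  | cons c v ih =>
    rw [lenSum, dynSum, shSum_cons, ih]
    push_cast [List.length_cons]
    module

theorem lenSum_nil_left (w : List L) (Φ : List L → N) :
    lenSum deg [] w Φ = dynSum deg [] w Φ := by
  cases w with
  | nil => rfl
  | cons c v =>
    rw [lenSum, dynSum, lenSum_cons_left]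
    simp only [shSum_nil_left, wdeg_nil, mul_zero, zpow_zero]
    module

/-- Every summand is a shuffle with non-empty left word; the one with empty right word carries the
weight `|q| = 0`. -/
theorem lenSum_cons_eq_zero (Φ : List L → N)
    (h : ∀ u v, u ≠ [] → v ≠ [] → shSum deg u v Φ = 0) (d : L) (r w : List L) :
    lenSum deg (d :: r) w Φ = 0 := by
  induction w generalizing d r with
  | nil => rfl
  | cons c v ih => rw [lenSum, ih, h _ _ (by simp) (by simp), smul_zero, smul_zero, sub_zero]

/-- The adjoint Dynkin operator is multiplication by the length modulo shuffles. -/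
theorem dynSum_nil_left (Φ : List L → N)
    (h : ∀ u v, u ≠ [] → v ≠ [] → shSum deg u v Φ = 0) (w : List L) :
    dynSum deg [] w Φ = (w.length : ℝ) • Φ w := by
  rw [← lenSum_nil_left]
  cases w with
  | nil => simp [lenSum]
  | cons c v =>
    rw [lenSum, lenSum_cons_eq_zero Φ h, shSum_nil_left]
    simp

/-- Each word occurring on the left ends either in `b` or in `d`, by `shSum_concat`. When the
distinguished letter is `b` itself nothing remains to its right, and the word ends in `d`. -/
theorem dynSum_concat (r w : List L) (d b : L) (Φ : List L → N) :
    dynSum deg (r ++ [d]) (w ++ [b]) Φ =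
      dynSum deg (r ++ [d]) w (fun x => Φ (x ++ [b])) +
      ((-1 : ℝ) ^ (deg d * wdeg deg (w ++ [b]))) •
        dynSum deg r (w ++ [b]) (fun x => Φ (x ++ [d])) := by
  induction w generalizing r with
  | nil =>
    simp only [List.nil_append, dynSum, shSum_nil_right, wdeg_append, wdeg_cons, wdeg_nil,
      add_zero, sub_zero, zero_add, smul_smul, sgn_mul, List.cons_append]
    congr 2
    ring
  | cons c v ih =>
    have i := ih (c :: r)
    simp only [List.cons_append] at i ⊢
    simp only [dynSum]
    rw [i, shSum_concat]
    have e : (-1 : ℝ) ^ (deg c * wdeg deg (r ++ [d])) *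
        (-1 : ℝ) ^ (deg d * wdeg deg (v ++ [b])) =
        (-1 : ℝ) ^ (deg d * wdeg deg (c :: (v ++ [b]))) * (-1 : ℝ) ^ (deg c * wdeg deg r) := by
      rw [sgn_mul, sgn_mul]
      congr 1
      simp
      ring
    simp only [List.cons_append, smul_add, smul_sub, smul_smul, e]
    module

/-- The recursion of the adjoint Dynkin operator. -/
theorem dynSum_nil_concat (a b : L) (w : List L) (Φ : List L → N) :
    dynSum deg [] (a :: (w ++ [b])) Φ =
      dynSum deg [] (a :: w) (fun x => Φ (x ++ [b])) -
      ((-1 : ℝ) ^ (deg a * wdeg deg (w ++ [b]))) •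
        dynSum deg [] (w ++ [b]) (fun x => Φ (x ++ [a])) := by
  have h := dynSum_concat (deg := deg) [] w a b Φ
  simp only [List.nil_append] at h
  rw [dynSum, dynSum, h]
  simp only [shSum_nil_left, wdeg_nil, mul_zero, zpow_zero, List.cons_append]
  module

theorem dynSum_map {N' : Type*} [AddCommGroup N'] [Module ℝ N'] (f : N →ₗ[ℝ] N') (r w : List L)
    (Φ : List L → N) : f (dynSum deg r w Φ) = dynSum deg r w (fun x => f (Φ x)) := by
  induction w generalizing r with
  | nil => simp [dynSum]
  | cons c v ih => simp only [dynSum, map_smul, map_sub, ih, shSum_map]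

/-! ### Deconcatenation against products and one-letter projections -/

/-- Deconcatenation is a morphism of complexes. -/
theorem mSum_dSum (w : List L) (Ψ : List L → List L → N) :
    mSum deg mul w (fun w' => dSum w' Ψ) =
      dSum w (fun u v => mSum deg mul u (fun u' => Ψ u' v) +
        ((-1 : ℝ) ^ wdeg deg u) • mSum deg mul v (fun v' => Ψ u v')) := by
  induction w generalizing Ψ with
  | nil => simp [mSum, dSum]
  | cons a l ih =>
    have key : headTerm deg mul a (fun w' => dSum w' Ψ) l =
        headTerm deg mul a (Ψ []) l +
          dSum l (fun u v => headTerm deg mul a (fun u' => Ψ u' v) u) := by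
      cases l with
      | nil => simp [headTerm, dSum]
      | cons b w => simp only [headTerm, dSum, dSum_smul, smul_add, zero_add]
    rw [mSum_cons]
    simp only [dSum]
    rw [mSum_add, ih, key]
    simp only [mSum_cons a, wdeg_nil, wdeg_cons, zpow_zero, one_smul, mSum, zero_add, ← sgn_mul,
      mul_smul, dSum_add, dSum_smul, smul_add]
    abel

theorem dSum_eq_first (a : L) (l : List L) (Φ : List L → List L → N)
    (h : ∀ u v, u.length ≠ 1 → Φ u v = 0) : dSum (a :: l) Φ = Φ [a] l := by
  rw [dSum, h [] _ (by simp), zero_add]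
  cases l with
  | nil => rfl
  | cons b l =>
    rw [dSum, dSum_congr l _ (fun _ _ => 0), dSum_zero, add_zero]
    intro u v _
    exact h _ _ (by simp)

theorem dSum_eq_last (b : L) (l : List L) (Φ : List L → List L → N)
    (h : ∀ u v, v.length ≠ 1 → Φ u v = 0) : dSum (l ++ [b]) Φ = Φ l [b] := by
  induction l generalizing Φ with
  | nil => simp [dSum, h [b] [] (by simp)]
  | cons c l ih =>
    rw [List.cons_append, dSum, h [] _ (by simp), zero_add, ih _ fun u v hv => h _ _ hv]

end Words

/-! ### Linear maps on tensors and on their classes are determined by words -/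

namespace Grading

variable {V N : Type*} [AddCommGroup V] [Module ℝ V] [AddCommGroup N] [Module ℝ N]
  (G : Grading V)

theorem hom_ext {f g : V →ₗ[ℝ] N} (h : ∀ a : G.Letter, f a.2 = g a.2) : f = g := by
  ext v
  have hv : v ∈ ⨆ i, G.gr i := by
    rw [G.internal.submodule_iSup_eq_top]; trivial
  induction hv using Submodule.iSup_induction' with
  | mem i x hx => exact h ⟨i, x, hx⟩
  | zero => simp
  | add x y _ _ hx hy => rw [map_add, map_add, hx, hy]

theorem span_word : Submodule.span ℝ (Set.range G.word) = ⊤ := by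
  set S := Submodule.span ℝ (Set.range G.word)
  have h1 : ∀ (v : V), ∀ y ∈ S, TensorAlgebra.ι ℝ v * y ∈ S := by
    intro v y hy
    -- Modulo `S`, membership of `v y` becomes the vanishing of a linear map in `v`, which can be
    -- tested on homogeneous `v`.
    have h : (S.mkQ ∘ₗ LinearMap.mulRight ℝ y ∘ₗ TensorAlgebra.ι ℝ : V →ₗ[ℝ] _) = 0 := by
      refine G.hom_ext fun a => ?_
      change S.mkQ (TensorAlgebra.ι ℝ (a.2 : V) * y) = 0
      rw [Submodule.mkQ_apply, Submodule.Quotient.mk_eq_zero]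
      induction hy using Submodule.span_induction with
      | mem y hy =>
        obtain ⟨w, rfl⟩ := hy
        exact Submodule.subset_span ⟨a :: w, rfl⟩
      | zero => simp
      | add x y _ _ hx hy => rw [mul_add]; exact S.add_mem hx hy
      | smul c x _ hx => rw [mul_smul_comm]; exact S.smul_mem c hx
    exact (Submodule.Quotient.mk_eq_zero S).1 (LinearMap.congr_fun h v)
  have h2 : ∀ x : Tens V, ∀ y ∈ S, x * y ∈ S := by
    intro x
    induction x using TensorAlgebra.induction with
    | algebraMap r => intro y hy; rw [← Algebra.smul_def]; exact S.smul_mem r hy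
    | ι v => exact h1 v
    | mul x y hx hy => intro z hz; rw [mul_assoc]; exact hx _ (hy _ hz)
    | add x y hx hy => intro z hz; rw [add_mul]; exact S.add_mem (hx _ hz) (hy _ hz)
  refine eq_top_iff.2 fun x _ => ?_
  simpa using h2 x 1 (Submodule.subset_span ⟨[], rfl⟩)

theorem tens_hom_ext {f g : Tens V →ₗ[ℝ] N} (h : ∀ w, f (G.word w) = g (G.word w)) : f = g :=
  LinearMap.ext_on_range G.span_word h

theorem cInf_hom_ext {f g : G.CInf →ₗ[ℝ] N}
    (h : ∀ w, f (G.cls (G.word w)) = g (G.cls (G.word w))) : f = g :=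
  Submodule.linearMap_qext _ (G.tens_hom_ext h)

theorem cls_word_nil : G.cls (G.word []) = 0 := G.cls_one

theorem cInf_induction {P : G.CInf → Prop} (hw : ∀ w, P (G.cls (G.word w)))
    (h0 : P 0) (hadd : ∀ x y, P x → P y → P (x + y)) (hsmul : ∀ (c : ℝ) x, P x → P (c • x))
    (x : G.CInf) : P x := by
  obtain ⟨t, rfl⟩ := Submodule.mkQ_surjective _ x
  have ht : t ∈ Submodule.span ℝ (Set.range G.word) := by rw [G.span_word]; trivial
  induction ht using Submodule.span_induction with
  | mem t ht => obtain ⟨w, rfl⟩ := ht; exact hw w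
  | zero => rw [map_zero]; exact h0
  | add x y _ _ hx hy => rw [map_add]; exact hadd _ _ hx hy
  | smul c x _ hx => rw [map_smul]; exact hsmul c _ hx

theorem cobracket_cls_word (w : List G.Letter) :
    G.cobracket (G.cls (G.word w)) =
      dSum w (fun u v => G.cls (G.word u) ⊗ₜ[ℝ] G.cls (G.word v) -
      ((-1 : ℝ) ^ (wdeg G.deg u * wdeg G.deg v)) •
        (G.cls (G.word v) ⊗ₜ[ℝ] G.cls (G.word u))) :=
  G.cobracketT_word w

theorem pr_cls_word_singleton (a : G.Letter) : G.pr (G.cls (G.word [a])) = (a.2 : V) :=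
  G.prT_singleton a

theorem pr_cls_word_eq_zero (w : List G.Letter) (h : w.length ≠ 1) :
    G.pr (G.cls (G.word w)) = 0 := by
  match w with
  | [] => exact G.prT_nil
  | [_] => simp at h
  | a :: b :: w => exact G.prT_cons_cons a b w

/-! ### Maps given by a sequence of maps on the summands `⊗ⁿ V[1] / shuffles` -/

/-- The algebra map `a₁ ⊗ ⋯ ⊗ aₙ ↦ (a₁ ⊗ ⋯ ⊗ aₙ) Xⁿ`. -/
noncomputable def lenPoly (V : Type*) [AddCommGroup V] [Module ℝ V] :
    Tens V →ₐ[ℝ] Polynomial (Tens V) :=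
  TensorAlgebra.lift ℝ ((Polynomial.monomial 1).restrictScalars ℝ ∘ₗ TensorAlgebra.ι ℝ)

theorem lenPoly_word (w : List G.Letter) :
    lenPoly V (G.word w) = Polynomial.monomial w.length (G.word w) := by
  induction w with
  | nil => simp [word]
  | cons a w ih =>
    rw [word, map_mul, ih, lenPoly, TensorAlgebra.lift_ι_apply]
    simp [Polynomial.monomial_mul_monomial, add_comm]

/-- The linear map which is `f n` on `⊗ⁿ V[1] / shuffles`. -/
noncomputable def glue (f : ℕ → G.CInf →ₗ[ℝ] N) : G.CInf →ₗ[ℝ] N :=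
  Submodule.liftQ _ (Polynomial.lsum (fun n => f n ∘ₗ G.cls) ∘ₗ (lenPoly V).toLinearMap)
    (G.le_ker _ (by
      have h := G.lenPoly_word []
      have h1 : f 0 (G.cls 1) = 0 := by rw [G.cls_one, map_zero]
      rw [word] at h
      rw [LinearMap.comp_apply, AlgHom.toLinearMap_apply, h, Polynomial.lsum_apply,
        Polynomial.sum_monomial_index _ _ (by simp)]
      exact h1) (by
      intro u v hu hv
      -- All words of a shuffle have the same length, so a single `f n` acts on the whole sum.
      rw [shSum_congr G.deg u v _ (fun w => f (u.length + v.length) (G.cls (G.word w))),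
        ← shSum_map, G.shSum_cls_word u v hu hv, map_zero]
      intro w hw
      simp [lenPoly_word, Polynomial.sum_monomial_index, hw.length_eq]))

theorem glue_cls_word (f : ℕ → G.CInf →ₗ[ℝ] N) (w : List G.Letter) :
    G.glue f (G.cls (G.word w)) = f w.length (G.cls (G.word w)) := by
  change (Polynomial.lsum (fun n => f n ∘ₗ G.cls)) (lenPoly V (G.word w)) = _
  simp [lenPoly_word, Polynomial.sum_monomial_index]

/-- Multiplication by the number of factors is inverted by dividing by it: only the empty word has
length zero. -/
theorem num_injective :
    Function.Injective (G.glue fun n => (n : ℝ) • (LinearMap.id : G.CInf →ₗ[ℝ] G.CInf)) := by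
  have h : (G.glue fun n => (n : ℝ)⁻¹ • (LinearMap.id : G.CInf →ₗ[ℝ] G.CInf)) ∘ₗ
      (G.glue fun n => (n : ℝ) • LinearMap.id) = LinearMap.id := by
    refine G.cInf_hom_ext fun w => ?_
    simp only [LinearMap.comp_apply, glue_cls_word, LinearMap.smul_apply, LinearMap.id_apply,
      map_smul, smul_smul]
    -- For the empty word the scalar `0 * 0⁻¹` is `0` and not `1`; this is harmless because the
    -- class is zero.
    cases w with
    | nil => rw [G.cls_word_nil, smul_zero]
    | cons a w => rw [mul_inv_cancel₀ (by simp; positivity), one_smul]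
  exact Function.LeftInverse.injective (LinearMap.congr_fun h)

/-! ### The kernel of the cobracket -/

/-- The sum of the iterated cobrackets `CInf → ⊗ᵏ V[1]`, `k ≤ n`. -/
noncomputable def dyn : ℕ → G.CInf →ₗ[ℝ] Tens V
  | 0 => 0
  | n + 1 => TensorAlgebra.ι ℝ ∘ₗ G.pr + LinearMap.mul' ℝ (Tens V) ∘ₗ
      TensorProduct.map (dyn n) (TensorAlgebra.ι ℝ ∘ₗ G.pr) ∘ₗ G.cobracket

theorem word_concat (w : List G.Letter) (a : G.Letter) :
    G.word (w ++ [a]) = G.word w * TensorAlgebra.ι ℝ (a.2 : V) := by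
  simp [word_append, word]

/-- Both sides obey the recursion `dynSum_nil_concat`: projecting the second factor of the cobracket
to one letter keeps only the cut before the last letter and, from the flipped half, the cut after
the first. The index `n` is a mere truncation, without effect once it reaches the length. -/
theorem dyn_cls_word (n : ℕ) (w : List G.Letter) (hw : w.length ≤ n) :
    G.dyn n (G.cls (G.word w)) = dynSum G.deg [] w G.word := by
  induction n generalizing w with
  | zero =>
    obtain rfl : w = [] := by simpa using hw
    rfl
  | succ n ih =>
    rcases w with _ | ⟨a, l⟩
    · rw [G.cls_word_nil, map_zero]; rfl
    rcases List.eq_nil_or_concat l with rfl | ⟨l, b, rfl⟩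
    · have h : G.cobracket (G.cls (G.word [a])) = 0 := by
        simp only [cobracket_cls_word, dSum, G.cls_word_nil, TensorProduct.zero_tmul,
          TensorProduct.tmul_zero, smul_zero, sub_zero, add_zero]
      simp only [dyn, LinearMap.add_apply, LinearMap.comp_apply, G.pr_cls_word_singleton, h]
      simp [dynSum, shSum_nil_left, word]
    · have e1 := ih (a :: l) (by simp at hw ⊢; omega)
      have e2 := ih (l ++ [b]) (by simp at hw ⊢; omega)
      simp only [List.concat_eq_append] at hw ⊢
      rw [dynSum_nil_concat]
      simp only [word_concat]
      have r : ∀ (c : V) (w : List G.Letter),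
          dynSum G.deg [] w (fun x => G.word x * TensorAlgebra.ι ℝ c) =
          dynSum G.deg [] w G.word * TensorAlgebra.ι ℝ c := fun c w =>
        (dynSum_map (LinearMap.mulRight ℝ (TensorAlgebra.ι ℝ c)) [] w G.word).symm
      rw [r, r, ← e1, ← e2, dyn]
      simp only [LinearMap.add_apply, LinearMap.comp_apply, cobracket_cls_word, dSum_map, map_sub,
        map_smul, TensorProduct.map_tmul, LinearMap.mul'_apply]
      -- With at least two letters the linear summand of `dyn` vanishes; in each half of the
      -- cobracket a single cut survives the projection.
      rw [dSum_sub, G.pr_cls_word_eq_zero _ (by simp),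
        dSum_eq_first a (l ++ [b]) (fun u v => ((-1 : ℝ) ^ (wdeg G.deg u * wdeg G.deg v)) •
          (G.dyn n (G.cls (G.word v)) * TensorAlgebra.ι ℝ (G.pr (G.cls (G.word u))))),
        ← List.cons_append, dSum_eq_last b (a :: l), G.pr_cls_word_singleton,
        G.pr_cls_word_singleton]
      · simp
      · intro u v hv
        rw [G.pr_cls_word_eq_zero v hv, map_zero, mul_zero]
      · intro u v hu
        rw [G.pr_cls_word_eq_zero u hu, map_zero, mul_zero, smul_zero]

/-- The kernel of the Lie cobracket consists of the tensors with one factor. -/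
theorem eq_zero_of_cobracket_eq_zero (x : G.CInf) (hδ : G.cobracket x = 0) (hp : G.pr x = 0) :
    x = 0 := by
  have h0 : ∀ n, G.dyn n x = 0 := by
    intro n
    cases n with
    | zero => rfl
    | succ n => simp [dyn, hδ, hp]
  -- The bound depends on `x`, which is a finite combination of words of various lengths. Together
  -- with `h0` this shows that multiplication by the number of factors kills `x`.
  have h1 : ∃ n₀, ∀ n, n₀ ≤ n → G.cls (G.dyn n x) =
      G.glue (fun n => (n : ℝ) • (LinearMap.id : G.CInf →ₗ[ℝ] G.CInf)) x := by
    clear h0 hδ hp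
    induction x using G.cInf_induction with
    | hw w =>
      refine ⟨w.length, fun n hn => ?_⟩
      rw [G.dyn_cls_word n w hn, glue_cls_word, dynSum_map, dynSum_nil_left _ G.shSum_cls_word]
      rfl
    | h0 => exact ⟨0, fun n _ => by simp⟩
    | hadd x y hx hy =>
      obtain ⟨k, hk⟩ := hx
      obtain ⟨l, hl⟩ := hy
      refine ⟨max k l, fun n hn => ?_⟩
      rw [map_add, map_add, map_add, hk n (by omega), hl n (by omega)]
    | hsmul c x hx =>
      obtain ⟨k, hk⟩ := hx
      refine ⟨k, fun n hn => ?_⟩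
      rw [map_smul, map_smul, map_smul, hk n hn]
  obtain ⟨n, hn⟩ := h1
  have h2 := hn n le_rfl
  rw [h0, map_zero] at h2
  exact G.num_injective (by rw [← h2, map_zero])

/-! ### The parity operator -/

/-- The operator `x ↦ (-1)^{deg x} x`. -/
noncomputable def sgn : G.CInf →ₗ[ℝ] G.CInf :=
  Submodule.liftQ _ (G.cls ∘ₗ G.signT) (G.le_ker _ (by simp [signT, G.cls_one]) (by
    intro u v hu hv
    rw [shSum_congr G.deg u v _ (fun w => ((-1 : ℝ) ^ wdeg G.deg (u ++ v)) • G.cls (G.word w)),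
      shSum_smul, G.shSum_cls_word u v hu hv, smul_zero]
    intro w hw
    have : wdeg G.deg w = wdeg G.deg (u ++ v) := (hw.map G.deg).sum_eq
    rw [LinearMap.comp_apply, signT_word, map_smul, this]))

theorem sgn_cls_word (w : List G.Letter) :
    G.sgn (G.cls (G.word w)) = ((-1 : ℝ) ^ wdeg G.deg w) • G.cls (G.word w) := by
  rw [← map_smul, ← G.signT_word]
  rfl

theorem sgn_mem {i : ℤ} {x : G.CInf} (hx : x ∈ G.degPart i) :
    G.sgn x = ((-1 : ℝ) ^ i) • x := by
  induction hx using Submodule.span_induction with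
  | mem x hx => obtain ⟨w, rfl, rfl⟩ := hx; exact G.sgn_cls_word w
  | zero => simp
  | add x y _ _ hx hy => rw [map_add, hx, hy, smul_add]
  | smul c x _ hx => rw [map_smul, hx, smul_comm]

end Grading

/-! ### Parity, and the codifferential as a coderivation of square zero -/

/-- Needed to carry the parity operator, which the coderivation rule of `m` puts on the first
factor, across a morphism of degree zero. -/
theorem IsLieCoalgHom.sgn_comp {V W : Type*} [AddCommGroup V] [Module ℝ V] [AddCommGroup W]
    [Module ℝ W] {G : Grading V} {H : Grading W} {F : G.CInf →ₗ[ℝ] H.CInf}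
    (hF : IsLieCoalgHom G H F) : H.sgn ∘ₗ F = F ∘ₗ G.sgn := by
  refine G.cInf_hom_ext fun w => ?_
  have hw : G.cls (G.word w) ∈ G.degPart (wdeg G.deg w) := Submodule.subset_span ⟨w, rfl, rfl⟩
  rw [LinearMap.comp_apply, LinearMap.comp_apply, H.sgn_mem (hF.deg_zero _ _ hw), G.sgn_mem hw,
    map_smul]

namespace GradedCommAlg

variable {R : Type*} [AddCommGroup R] [Module ℝ R] (A : GradedCommAlg R)

theorem mulLetter_assoc (a b c : A.Letter) :
    A.mulLetter (A.mulLetter a b) c = A.mulLetter a (A.mulLetter b c) :=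
  Sigma.subtype_ext (add_assoc _ _ _) (A.mul_assoc _ _ _)

theorem m_comp_m : A.m ∘ₗ A.m = 0 := by
  refine A.cInf_hom_ext fun w => ?_
  rw [LinearMap.comp_apply, A.m_cls_word, mSum_map]
  simp only [A.m_cls_word]
  exact mSum_mSum A.deg_mulLetter A.mulLetter_assoc w _

theorem m_mem_lenPart (n : ℕ) (x : A.CInf) (hx : x ∈ A.lenPart (n + 1)) :
    A.m x ∈ A.lenPart n := by
  induction hx using Submodule.span_induction with
  | mem x hx =>
    obtain ⟨w, hw, rfl⟩ := hx
    rw [A.m_cls_word]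
    refine mSum_mem _ w _ fun w' hw' => Submodule.subset_span ⟨w', ?_, rfl⟩
    have := length_merges w w' hw'
    omega
  | zero => rw [map_zero]; exact Submodule.zero_mem _
  | add x y _ _ hx hy => rw [map_add]; exact Submodule.add_mem _ hx hy
  | smul c x _ hx => rw [map_smul]; exact Submodule.smul_mem _ c hx

/-- The codifferential is a coderivation of the Lie coalgebra. -/
theorem cobracket_comp_m :
    A.cobracket ∘ₗ A.m = (TensorProduct.map A.m LinearMap.id + TensorProduct.map A.sgn A.m) ∘ₗ
      A.cobracket := by
  refine A.cInf_hom_ext fun w => ?_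
  rw [LinearMap.comp_apply, LinearMap.comp_apply, A.m_cls_word, mSum_map,
    A.cobracket_cls_word, dSum_map]
  simp only [A.cobracket_cls_word]
  rw [mSum_dSum]
  refine dSum_congr _ _ _ fun u v _ => ?_
  set x : List A.Letter → A.CInf := fun w => A.cls (A.word w) with hx
  -- A product raises the degree of `u` by one, so the Koszul sign of the flipped half changes with
  -- it; `e2` is the same for `v`.
  have e1 : mSum A.deg A.mulLetter u (fun u' => x u' ⊗ₜ[ℝ] x v -
      ((-1 : ℝ) ^ (wdeg A.deg u' * wdeg A.deg v)) • (x v ⊗ₜ[ℝ] x u')) =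
      A.m (x u) ⊗ₜ[ℝ] x v -
      ((-1 : ℝ) ^ ((wdeg A.deg u + 1) * wdeg A.deg v)) • (x v ⊗ₜ[ℝ] A.m (x u)) := by
    have := mSum_map (deg := A.deg) (mul := A.mulLetter)
      ((TensorProduct.mk ℝ A.CInf A.CInf).flip (x v) -
        ((-1 : ℝ) ^ ((wdeg A.deg u + 1) * wdeg A.deg v)) • TensorProduct.mk ℝ A.CInf A.CInf (x v))
      u x
    rw [← A.m_cls_word] at this
    refine Eq.trans (mSum_congr _ _ _ fun w hw => ?_) this.symm
    rw [wdeg_merges A.deg_mulLetter u w hw]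
    rfl
  have e2 : mSum A.deg A.mulLetter v (fun v' => x u ⊗ₜ[ℝ] x v' -
      ((-1 : ℝ) ^ (wdeg A.deg u * wdeg A.deg v')) • (x v' ⊗ₜ[ℝ] x u)) =
      x u ⊗ₜ[ℝ] A.m (x v) -
      ((-1 : ℝ) ^ (wdeg A.deg u * (wdeg A.deg v + 1))) • (A.m (x v) ⊗ₜ[ℝ] x u) := by
    have := mSum_map (deg := A.deg) (mul := A.mulLetter)
      (TensorProduct.mk ℝ A.CInf A.CInf (x u) -
        ((-1 : ℝ) ^ (wdeg A.deg u * (wdeg A.deg v + 1))) •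
          (TensorProduct.mk ℝ A.CInf A.CInf).flip (x u))
      v x
    rw [← A.m_cls_word] at this
    refine Eq.trans (mSum_congr _ _ _ fun w hw => ?_) this.symm
    rw [wdeg_merges A.deg_mulLetter v w hw]
    rfl
  change mSum A.deg A.mulLetter u (fun u' => x u' ⊗ₜ[ℝ] x v -
      ((-1 : ℝ) ^ (wdeg A.deg u' * wdeg A.deg v)) • (x v ⊗ₜ[ℝ] x u')) +
    ((-1 : ℝ) ^ wdeg A.deg u) • mSum A.deg A.mulLetter v (fun v' => x u ⊗ₜ[ℝ] x v' -
      ((-1 : ℝ) ^ (wdeg A.deg u * wdeg A.deg v')) • (x v' ⊗ₜ[ℝ] x u)) = _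
  rw [e1, e2]
  simp only [LinearMap.add_apply, map_sub, map_smul, TensorProduct.map_tmul, LinearMap.id_apply,
    A.sgn_cls_word, hx, ← TensorProduct.smul_tmul', add_mul, mul_add,
    one_mul, mul_one, ← sgn_mul]
  -- In the term `m(v) ⊗ u` the sign `(-1)^{deg u}` enters twice: once from `m` passing `u`, once
  -- from the changed Koszul sign.
  have q := sgn_mul_self (wdeg A.deg u)
  generalize (-1 : ℝ) ^ wdeg A.deg u = s at *
  match_scalars <;> first | ring1 | linear_combination (-(-1 : ℝ) ^ (wdeg A.deg u * wdeg A.deg v)) * q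

end GradedCommAlg

namespace SymmBimodule

variable {R M : Type*} [AddCommGroup R] [Module ℝ R] [AddCommGroup M] [Module ℝ M]
  {A : GradedCommAlg R} (B : SymmBimodule A M)

/-! ### The Harrison chains as a subcomplex -/

section Expand

variable {N : Type*} [AddCommGroup N] [Module ℝ N]

/-- The component in `R` of a homogeneous element of `R ⋉ M`. -/
def fstLetter (s : B.semidirect.Letter) : B.MLetter := .inl ⟨s.1, (s.2 : R × M).1, s.2.2.1⟩

/-- The component in `M` of a homogeneous element of `R ⋉ M`. -/
def sndLetter (s : B.semidirect.Letter) : B.MLetter := .inr ⟨s.1, (s.2 : R × M).2, s.2.2.2⟩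

/-- The sum of `Φ` over all words obtained by replacing each letter by one of its two
components. -/
def expandSum : List B.semidirect.Letter → (List B.MLetter → N) → N
  | [], Φ => Φ []
  | s :: w, Φ => expandSum w (fun x => Φ (B.fstLetter s :: x)) +
      expandSum w (fun x => Φ (B.sndLetter s :: x))

theorem expandSum_cons (s : B.semidirect.Letter) (w : List B.semidirect.Letter)
    (Φ : List B.MLetter → N) :
    B.expandSum (s :: w) Φ = B.expandSum w (fun x => Φ (B.fstLetter s :: x)) +
      B.expandSum w (fun x => Φ (B.sndLetter s :: x)) := rfl

/-- Expansion preserves length and degree. Only words with the same invariants need be compared, and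
this is what lets Koszul signs be identified before and after expansion. -/
theorem expandSum_congr (w : List B.semidirect.Letter) (Φ Ψ : List B.MLetter → N)
    (h : ∀ x, x.length = w.length → wdeg B.mdeg x = wdeg B.semidirect.deg w → Φ x = Ψ x) :
    B.expandSum w Φ = B.expandSum w Ψ := by
  induction w generalizing Φ Ψ with
  | nil => exact h [] rfl rfl
  | cons s w ih =>
    rw [expandSum, expandSum]
    congr 1
    · refine ih _ _ fun x hl hx => h _ (by simp [hl]) ?_
      rw [wdeg_cons, wdeg_cons, hx]
      rfl
    · refine ih _ _ fun x hl hx => h _ (by simp [hl]) ?_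
      rw [wdeg_cons, wdeg_cons, hx]
      rfl

theorem expandSum_add (w : List B.semidirect.Letter) (Φ Ψ : List B.MLetter → N) :
    B.expandSum w (fun x => Φ x + Ψ x) = B.expandSum w Φ + B.expandSum w Ψ := by
  induction w generalizing Φ Ψ with
  | nil => rfl
  | cons s w ih => simp only [expandSum, ih]; abel

theorem expandSum_map {N' : Type*} [AddCommGroup N'] [Module ℝ N'] (f : N →ₗ[ℝ] N')
    (w : List B.semidirect.Letter) (Φ : List B.MLetter → N) :
    f (B.expandSum w Φ) = B.expandSum w (fun x => f (Φ x)) := by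
  induction w generalizing Φ with
  | nil => rfl
  | cons s w ih => simp only [expandSum, map_add, ih]

theorem expandSum_smul (c : ℝ) (w : List B.semidirect.Letter) (Φ : List B.MLetter → N) :
    B.expandSum w (fun x => c • Φ x) = c • B.expandSum w Φ :=
  (B.expandSum_map (LinearMap.lsmul ℝ N c) w Φ).symm

theorem expandSum_zero (w : List B.semidirect.Letter) :
    B.expandSum w (fun _ => (0 : N)) = 0 := by
  simpa using B.expandSum_smul (0 : ℝ) w (fun _ => (0 : N))

/-- Shuffles are multilinear in the letters. -/
theorem shSum_expandSum (u v : List B.semidirect.Letter) (Φ : List B.MLetter → N) :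
    shSum B.semidirect.deg u v (fun w => B.expandSum w Φ) =
      B.expandSum u (fun x => B.expandSum v (fun y => shSum B.mdeg x y Φ)) := by
  obtain ⟨n, hn⟩ : ∃ n, n = u.length + v.length := ⟨_, rfl⟩
  induction n using Nat.strong_induction_on generalizing u v Φ with
  | _ n ih =>
  cases u with
  | nil => simp only [shSum_nil_left, expandSum]
  | cons a u =>
  cases v with
  | nil => simp only [shSum_nil_right, expandSum]
  | cons b v =>
    have i1 := fun Φ => ih _ (by simp at hn; simp; omega) u (b :: v) Φ rfl
    have i2 := fun Φ => ih _ (by simp at hn; simp; omega) (a :: u) v Φ rfl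
    rw [shSum_cons]
    simp only [B.expandSum_cons a]
    simp only [B.expandSum_cons b]
    rw [shSum_add, shSum_add, i1, i1, i2, i2]
    simp only [expandSum, ← expandSum_smul, ← expandSum_add, smul_add]
    -- What remains is the recursion of `shSum` for each of the four choices of components of `a`
    -- and `b`; all four carry the same sign.
    refine B.expandSum_congr _ _ _ fun x _ hx => B.expandSum_congr _ _ _ fun y _ hy => ?_
    have h1 : wdeg B.mdeg (B.fstLetter a :: x) = wdeg B.semidirect.deg (a :: u) := by
      rw [wdeg_cons, wdeg_cons, hx]; rfl
    have h2 : wdeg B.mdeg (B.sndLetter a :: x) = wdeg B.semidirect.deg (a :: u) := by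
      rw [wdeg_cons, wdeg_cons, hx]; rfl
    have h3 : B.mdeg (B.fstLetter b) = B.semidirect.deg b := rfl
    have h4 : B.mdeg (B.sndLetter b) = B.semidirect.deg b := rfl
    simp only [shSum_cons, h1, h2, h3, h4]
    abel

end Expand

/-! ### The retraction of `C_∞(R ⋉ M)` onto the Harrison chains -/

/-- The projection of tensors on `R ⋉ M` onto tensors on `R`. -/
noncomputable def tensFst (R M : Type*) [AddCommGroup R] [Module ℝ R] [AddCommGroup M]
    [Module ℝ M] : Tens (R × M) →ₐ[ℝ] Tens R :=
  TensorAlgebra.lift ℝ (TensorAlgebra.ι ℝ ∘ₗ LinearMap.fst ℝ R M)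

/-- The projection of tensors on `R ⋉ M` onto tensors with one factor in `M`. -/
noncomputable def projT : Tens (R × M) →ₗ[ℝ] B.ChainT :=
  tensRec
    ((TensorProduct.mk ℝ M (Tens R) ∘ₗ LinearMap.snd ℝ R M).compr₂
      (TensorProduct.mk ℝ (Tens R) (M ⊗[ℝ] Tens R) 1) |>.compl₂ (tensFst R M).toLinearMap)
    (LinearMap.rTensorHom (M ⊗[ℝ] Tens R) ∘ₗ lmul ∘ₗ LinearMap.fst ℝ R M) 0

theorem projT_one : B.projT 1 = 0 := tensRec_one _ _ _

theorem projT_mul (s : R × M) (t : Tens (R × M)) :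
    B.projT (TensorAlgebra.ι ℝ s * t) = 1 ⊗ₜ[ℝ] (s.2 ⊗ₜ[ℝ] tensFst R M t) +
      LinearMap.rTensor (M ⊗[ℝ] Tens R) (lmul s.1) (B.projT t) :=
  tensRec_mul _ _ _ s t

theorem tensFst_word (w : List B.semidirect.Letter) :
    tensFst R M (B.semidirect.word w) = B.expandSum w B.pureWord := by
  induction w with
  | nil => simp [Grading.word, expandSum, pureWord]
  | cons s w ih =>
    have h := B.expandSum_map (lmul (s.2 : R × M).1) w B.pureWord
    rw [Grading.word, map_mul, ih, expandSum]
    simp only [fstLetter, sndLetter, pureWord, expandSum_zero, add_zero]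
    refine Eq.trans ?_ h
    simp [tensFst]

theorem projT_word (w : List B.semidirect.Letter) :
    B.projT (B.semidirect.word w) = B.expandSum w B.mixedWord := by
  induction w with
  | nil => exact B.projT_one
  | cons s w ih =>
    rw [Grading.word, projT_mul, ih, expandSum, tensFst_word, add_comm, expandSum_map]
    congr 1
    exact B.expandSum_map (TensorProduct.mk ℝ _ _ (1 : Tens R) ∘ₗ
        TensorProduct.mk ℝ M (Tens R) (s.2 : R × M).2) w B.pureWord

theorem pureWord_eq_zero (w : List B.MLetter) (h : B.numM w ≠ 0) : B.pureWord w = 0 := by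
  induction w with
  | nil => simp [numM] at h
  | cons x w ih =>
    rcases x with a | v
    · rw [pureWord, ih (by rwa [numM_inl] at h), mul_zero]
    · rfl

theorem mixedWord_eq_zero (w : List B.MLetter) (h : B.numM w ≠ 1) : B.mixedWord w = 0 := by
  induction w with
  | nil => rfl
  | cons x w ih =>
    rcases x with a | v
    · rw [mixedWord, ih (by rwa [numM_inl] at h), map_zero]
    · rw [mixedWord, B.pureWord_eq_zero w (by rw [numM_inr] at h; omega), TensorProduct.tmul_zero,
        TensorProduct.tmul_zero]

/-- Expanding a shuffle in `R ⋉ M` produces words with any number of letters from `M`. If the number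
is not one, every interleaving already has tensor zero, so no condition on it is needed here. -/
theorem chainCls_shSum_mixedWord (u v : List B.MLetter) (hu : u ≠ []) (hv : v ≠ []) :
    B.chainCls (shSum B.mdeg u v B.mixedWord) = 0 := by
  by_cases h : B.numM u + B.numM v = 1
  · exact B.chainCls_shSum u v hu hv h
  · rw [shSum_congr B.mdeg u v _ (fun _ => 0), shSum_zero, map_zero]
    intro w hw
    exact B.mixedWord_eq_zero w (by rwa [B.numM_perm hw, numM_append])

/-- The projection of `C_∞(R ⋉ M)` onto the Harrison chains of `M`. -/
noncomputable def proj : B.semidirect.CInf →ₗ[ℝ] B.Chains :=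
  Submodule.liftQ _ (B.chainCls ∘ₗ B.projT) (B.semidirect.le_ker _
    (by rw [LinearMap.comp_apply, projT_one, map_zero]) (by
      intro u v hu hv
      -- After expansion the image is a double sum of shuffles of component words. These are
      -- non-empty, having the lengths of `u` and `v`, so every summand has class zero.
      simp only [LinearMap.comp_apply, projT_word]
      rw [← shSum_map, shSum_expandSum, expandSum_map]
      rw [B.expandSum_congr u _ (fun _ => 0), expandSum_zero]
      intro x hx _
      rw [expandSum_map, B.expandSum_congr v _ (fun _ => 0), expandSum_zero]
      intro y hy _
      refine B.chainCls_shSum_mixedWord x y ?_ ?_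
      · rintro rfl; exact hu (List.length_eq_zero_iff.1 hx.symm)
      · rintro rfl; exact hv (List.length_eq_zero_iff.1 hy.symm)))

theorem tensFst_tensInl (y : Tens R) : tensFst R M (tensInl R M y) = y := by
  have : (tensFst R M).comp (tensInl R M) = AlgHom.id ℝ (Tens R) := by
    ext a
    simp [tensFst, tensInl]
  exact AlgHom.congr_fun this y

/-- Induction on the `R`-word to the left of `v`: a letter of `R` has no component in `M` and is
only carried along, while `v` has no component in `R` and starts the mixed tensor. -/
theorem projT_inclT (x : B.ChainT) : B.projT (B.inclT x) = x := by
  have h : B.projT ∘ₗ B.inclT = LinearMap.id := by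
    refine TensorProduct.ext ?_
    refine A.tens_hom_ext (N := M ⊗[ℝ] Tens R →ₗ[ℝ] B.ChainT) fun w => ?_
    refine TensorProduct.ext' fun v y => ?_
    change B.projT (B.inclT (A.word w ⊗ₜ (v ⊗ₜ y))) = A.word w ⊗ₜ (v ⊗ₜ y)
    have e : ∀ t : Tens R, B.inclT (t ⊗ₜ (v ⊗ₜ y)) =
        tensInl R M t * (TensorAlgebra.ι ℝ ((0 : R), v) * tensInl R M y) := fun t => by
      simp [inclT]
    rw [e]
    induction w with
    | nil => simp [Grading.word, projT_mul, tensFst_tensInl]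
    | cons a w ih =>
      have ea : tensInl R M (TensorAlgebra.ι ℝ (a.2 : R)) =
          TensorAlgebra.ι ℝ ((a.2 : R), (0 : M)) := by
        simp [tensInl]
      rw [Grading.word, map_mul (tensInl R M), mul_assoc, ea, projT_mul, ih]
      simp
  exact LinearMap.congr_fun h x

/-- The quotient in the target is by more shuffles than the one in the source, but `proj` kills them
all, so the retraction of tensors descends to classes. -/
theorem incl_injective : Function.Injective B.incl := by
  have h : ∀ x, B.proj (B.incl x) = x := by
    intro x
    obtain ⟨t, rfl⟩ := Submodule.mkQ_surjective _ x
    change B.chainCls (B.projT (B.inclT t)) = B.chainCls t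
    rw [projT_inclT]
  exact Function.LeftInverse.injective h

/-! ### The boundary compared with the codifferential -/

theorem chains_hom_ext {N : Type*} [AddCommGroup N] [Module ℝ N] {f g : B.Chains →ₗ[ℝ] N}
    (h : ∀ w, B.numM w = 1 → f (B.chainCls (B.mixedWord w)) = g (B.chainCls (B.mixedWord w))) :
    f = g := by
  refine Submodule.linearMap_qext _ (TensorProduct.ext (A.tens_hom_ext fun u => ?_))
  refine TensorProduct.ext (B.hom_ext fun v => A.tens_hom_ext fun u' => ?_)
  have := h (u.map Sum.inl ++ Sum.inr v :: u'.map Sum.inl) (by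
    have h0 : ∀ l : List A.Letter, B.numM (l.map Sum.inl) = 0 := fun l => by
      simp [numM, List.countP_map, Function.comp_def]
    rw [numM_append, numM_inr, h0, h0])
  rw [mixedWord_split] at this
  exact this

theorem boundary_chainCls (w : List B.MLetter) (h : B.numM w = 1) :
    B.boundary (B.chainCls (B.mixedWord w)) =
      mSum B.mdeg B.mmul w (fun w' => B.chainCls (B.mixedWord w')) := by
  rw [← mSum_map, ← B.boundaryT_mixedWord w h]
  rfl

theorem incl_chainCls (w : List B.MLetter) (h : B.numM w = 1) :
    B.incl (B.chainCls (B.mixedWord w)) =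
      B.semidirect.cls (B.semidirect.word (w.map B.inclLetter)) := by
  rw [← B.inclT_mixedWord w h]
  rfl

theorem boundary_mem_chainPart (n : ℕ) (x : B.Chains) (hx : x ∈ B.chainPart (n + 1)) :
    B.boundary x ∈ B.chainPart n := by
  induction hx using Submodule.span_induction with
  | mem x hx =>
    obtain ⟨w, h1, hw, rfl⟩ := hx
    rw [B.boundary_chainCls w h1]
    refine mSum_mem _ w _ fun w' hw' => Submodule.subset_span ⟨w', ?_, ?_, rfl⟩
    · rw [B.numM_merges w w' h1.le hw', h1]
    · have := length_merges w w' hw'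
      omega
  | zero => rw [map_zero]; exact Submodule.zero_mem _
  | add x y _ _ hx hy => rw [map_add]; exact Submodule.add_mem _ hx hy
  | smul c x _ hx => rw [map_smul]; exact Submodule.smul_mem _ c hx

theorem incl_mem_lenPart (n : ℕ) (x : B.Chains) (hx : x ∈ B.chainPart n) :
    B.incl x ∈ B.semidirect.lenPart n := by
  induction hx using Submodule.span_induction with
  | mem x hx =>
    obtain ⟨w, h1, hw, rfl⟩ := hx
    rw [B.incl_chainCls w h1]
    exact Submodule.subset_span ⟨_, by simpa using hw, rfl⟩
  | zero => rw [map_zero]; exact Submodule.zero_mem _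
  | add x y _ _ hx hy => rw [map_add]; exact Submodule.add_mem _ hx hy
  | smul c x _ hx => rw [map_smul]; exact Submodule.smul_mem _ c hx

/-- With two letters of `M` both sides are zero, because `M` has square zero in `R ⋉ M`. -/
theorem inclLetter_mmul (a b : B.MLetter) :
    B.inclLetter (B.mmul a b) = B.semidirect.mulLetter (B.inclLetter a) (B.inclLetter b) := by
  rcases a with a | a <;> rcases b with b | b <;> refine Sigma.subtype_ext rfl ?_ <;>
    simp [inclLetter, mmul, GradedCommAlg.mulLetter, semidirect]

theorem m_comp_incl : B.semidirect.m ∘ₗ B.incl = B.incl ∘ₗ B.boundary := by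
  refine B.chains_hom_ext fun w h => ?_
  rw [LinearMap.comp_apply, LinearMap.comp_apply, B.incl_chainCls w h, B.boundary_chainCls w h,
    B.semidirect.m_cls_word, mSum_map,
    mSum_mapLetter B.inclLetter B.deg_inclLetter B.inclLetter_mmul]
  refine mSum_congr _ _ _ fun w' hw' => ?_
  rw [B.incl_chainCls w' (by rw [B.numM_merges w w' h.le hw', h])]

/-- Pulled back from `m² = 0` along the injective chain map `incl`; no separate sign computation is
required. -/
theorem boundary_comp_boundary : B.boundary ∘ₗ B.boundary = 0 := by
  refine LinearMap.ext fun x => B.incl_injective ?_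
  have h := LinearMap.congr_fun B.m_comp_incl
  simp only [LinearMap.comp_apply] at h
  rw [LinearMap.comp_apply, ← h, ← h]
  simpa using LinearMap.congr_fun B.semidirect.m_comp_m (B.incl x)

end SymmBimodule

/-! ### Morphisms are determined by their projections -/

/-- A coderivation along a morphism of the Lie coalgebras is determined by its projection. -/
theorem eq_zero_of_coderivation {V W : Type*} [AddCommGroup V] [Module ℝ V] [AddCommGroup W]
    [Module ℝ W] {G : Grading V} {H : Grading W} (D F F' : G.CInf →ₗ[ℝ] H.CInf)
    (hD : H.cobracket ∘ₗ D = (TensorProduct.map D F + TensorProduct.map F' D) ∘ₗ G.cobracket)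
    (hp : H.pr ∘ₗ D = 0) : D = 0 := by
  refine G.cInf_hom_ext fun w => ?_
  obtain ⟨n, hn⟩ : ∃ n, n = w.length := ⟨_, rfl⟩
  induction n using Nat.strong_induction_on generalizing w with
  | _ n ih =>
  refine H.eq_zero_of_cobracket_eq_zero _ ?_ (LinearMap.congr_fun hp _)
  have h := LinearMap.congr_fun hD (G.cls (G.word w))
  rw [LinearMap.comp_apply, LinearMap.comp_apply, G.cobracket_cls_word, dSum_map] at h
  -- The cobracket of `D w` involves `D` only on the two pieces of a proper cut, which are shorter
  -- than `w`. So `D w` lies in the kernel of the cobracket, and its projection is zero by `hp`.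
  rw [h, dSum_congr w _ (fun _ _ => 0), dSum_zero]
  intro u v huv
  by_cases hu : u = []
  · simp [hu, G.cls_word_nil]
  by_cases hv : v = []
  · simp [hv, G.cls_word_nil]
  have h1 := List.length_pos_iff.2 hu
  have h2 := List.length_pos_iff.2 hv
  have h3 := congrArg List.length huv
  rw [List.length_append] at h3
  have i1 := ih u.length (by omega) u rfl
  have i2 := ih v.length (by omega) v rfl
  simp [i1, i2]

/-! ### The projection of the codifferential to one factor -/

theorem Grading.pr_mem {V : Type*} [AddCommGroup V] [Module ℝ V] (G : Grading V) {i : ℤ}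
    {x : G.CInf} (hx : x ∈ G.degPart i) : G.pr x ∈ G.gr (i + 1) := by
  induction hx using Submodule.span_induction with
  | mem x hx =>
    obtain ⟨w, rfl, rfl⟩ := hx
    match w with
    | [] => rw [G.pr_cls_word_eq_zero _ (by simp)]; exact Submodule.zero_mem _
    | [a] =>
      rw [G.pr_cls_word_singleton]
      have : wdeg G.deg [a] + 1 = a.1 := by simp [Grading.deg]
      rw [this]
      exact a.2.2
    | a :: b :: w => rw [G.pr_cls_word_eq_zero _ (by simp)]; exact Submodule.zero_mem _
  | zero => rw [map_zero]; exact Submodule.zero_mem _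
  | add x y _ _ hx hy => rw [map_add]; exact Submodule.add_mem _ hx hy
  | smul c x _ hx => rw [map_smul]; exact Submodule.smul_mem _ c hx

namespace GradedCommAlg

variable {R S : Type*} [AddCommGroup R] [Module ℝ R] [AddCommGroup S] [Module ℝ S]
  (A : GradedCommAlg R) (A' : GradedCommAlg S)

/-- The shift turns graded commutativity into graded antisymmetry, the symmetry type of the
cobracket. -/
theorem mul2_comm {i j : ℤ} {x y : R} (hx : x ∈ A.gr (i + 1)) (hy : y ∈ A.gr (j + 1)) :
    A.mul2 (y ⊗ₜ x) = -(((-1 : ℝ) ^ (i * j)) • A.mul2 (x ⊗ₜ y)) := by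
  simp only [mul2, TensorProduct.lift.tmul, LinearMap.comp_apply]
  rw [SymmBimodule.sign_mem A.toGrading 1 hx, SymmBimodule.sign_mem A.toGrading 1 hy]
  simp only [map_smul, LinearMap.smul_apply]
  rw [A.mul_comm hy hx, smul_smul, smul_smul, sgn_mul, sgn_mul, ← neg_smul]
  congr 1
  exact sgn_eq_neg ⟨j, by ring⟩

/-- A product removes exactly one letter, so only two-letter words contribute to either side. -/
theorem pr_m_cls_word (w : List A.Letter) :
    A.pr (A.m (A.cls (A.word w))) =
      dSum w (fun u v => A.mul2 (A.pr (A.cls (A.word u)) ⊗ₜ A.pr (A.cls (A.word v)))) := by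
  rw [A.m_cls_word, mSum_map]
  cases w with
  | nil => simp [mSum, dSum, A.cls_word_nil]
  | cons a l =>
    rw [dSum_eq_first a l, A.pr_cls_word_singleton]
    · by_cases hl : l.length = 1
      · obtain ⟨b, rfl⟩ := List.length_eq_one_iff.1 hl
        rw [A.pr_cls_word_singleton]
        simp only [mSum, A.pr_cls_word_singleton, smul_zero, add_zero, mul2,
          TensorProduct.lift.tmul, LinearMap.comp_apply, A.sign_apply, one_mul, map_smul,
          LinearMap.smul_apply]
        rfl
      · rw [A.pr_cls_word_eq_zero l hl, TensorProduct.tmul_zero, map_zero]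
        refine (Submodule.mem_bot ℝ).1 (mSum_mem ⊥ _ _ fun w' hw' => (Submodule.mem_bot ℝ).2
          (A.pr_cls_word_eq_zero w' ?_))
        have := length_merges _ w' hw'
        rw [List.length_cons] at this
        omega
    · intro u v hu
      rw [A.pr_cls_word_eq_zero u hu, TensorProduct.zero_tmul, map_zero]

/-- The two halves of the cobracket contribute equally, as the product is antisymmetric in the
shifted degrees; hence the factor `2`. -/
theorem mul2_cobracket {f : A.CInf →ₗ[ℝ] S}
    (hf : ∀ i, ∀ x ∈ A.degPart i, f x ∈ A'.gr (i + 1)) (w : List A.Letter) :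
    A'.mul2 (TensorProduct.map f f (A.cobracket (A.cls (A.word w)))) =
      (2 : ℝ) • dSum w (fun u v => A'.mul2 (f (A.cls (A.word u)) ⊗ₜ f (A.cls (A.word v)))) := by
  rw [A.cobracket_cls_word, dSum_map, dSum_map, ← dSum_smul]
  refine dSum_congr _ _ _ fun u v _ => ?_
  have hu := hf _ _ (SymmBimodule.cls_word_mem u)
  have hv := hf _ _ (SymmBimodule.cls_word_mem v)
  simp only [map_sub, map_smul, TensorProduct.map_tmul]
  rw [A'.mul2_comm hu hv, smul_neg, smul_smul, sgn_mul_self]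
  module

/-- Deconcatenation is not defined on the quotient by shuffles, but the cobracket is. In this form
the projection of `m` can be transported along a morphism of Lie coalgebras. -/
theorem pr_m (x : A.CInf) :
    A.pr (A.m x) = (1 / 2 : ℝ) • A.mul2 (TensorProduct.map A.pr A.pr (A.cobracket x)) := by
  have h : A.pr ∘ₗ A.m =
      (1 / 2 : ℝ) • (A.mul2 ∘ₗ TensorProduct.map A.pr A.pr ∘ₗ A.cobracket) := by
    refine A.cInf_hom_ext fun w => ?_
    simp only [LinearMap.comp_apply, LinearMap.smul_apply]
    rw [A.mul2_cobracket A fun i x hx => A.pr_mem hx, pr_m_cls_word]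
    module
  exact LinearMap.congr_fun h x

variable {A A'} {F : A.CInf →ₗ[ℝ] A'.CInf}

/-- Since `F` preserves cobrackets, the quadratic formula for `pr ∘ m` can be evaluated on cuts of
the source word, with `pr ∘ F` applied to both pieces. -/
theorem pr_m_hom (hF : IsLieCoalgHom A.toGrading A'.toGrading F) (w : List A.Letter) :
    A'.pr (A'.m (F (A.cls (A.word w)))) = dSum w (fun u v =>
      A'.mul2 (A'.pr (F (A.cls (A.word u))) ⊗ₜ A'.pr (F (A.cls (A.word v))))) := by
  have h := LinearMap.congr_fun hF.cobracket_comp (A.cls (A.word w))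
  rw [LinearMap.comp_apply, LinearMap.comp_apply] at h
  have k := A.mul2_cobracket A' (f := A'.pr ∘ₗ F)
    (fun i x hx => A'.pr_mem (hF.deg_zero i x hx)) w
  rw [TensorProduct.map_comp, LinearMap.comp_apply] at k
  rw [pr_m, ← h, k]
  simp only [LinearMap.comp_apply]
  module

/-- The defect `m F - F m` is a coderivation along `F`, hence determined by its projection to one
factor. -/
theorem hom_comm_iff (hF : IsLieCoalgHom A.toGrading A'.toGrading F) :
    A'.m ∘ₗ F = F ∘ₗ A.m ↔ A'.pr ∘ₗ A'.m ∘ₗ F = A'.pr ∘ₗ F ∘ₗ A.m := by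
  refine ⟨fun h => by rw [h], fun h => sub_eq_zero.1 ?_⟩
  -- The parity on the first factor is the Koszul sign of the odd defect passing that factor.
  refine eq_zero_of_coderivation _ F (A'.sgn ∘ₗ F) ?_ (by rw [LinearMap.comp_sub, h, sub_self])
  refine LinearMap.ext fun x => ?_
  have h1 := LinearMap.congr_fun A'.cobracket_comp_m (F x)
  have h2 := LinearMap.congr_fun A.cobracket_comp_m x
  have h3 := LinearMap.congr_fun hF.cobracket_comp
  have h4 := LinearMap.congr_fun hF.sgn_comp
  simp only [LinearMap.comp_apply] at h1 h2 h3 h4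
  simp only [LinearMap.comp_apply, LinearMap.sub_apply, map_sub]
  rw [h1, ← h3, ← h3, h2]
  generalize A.cobracket x = t
  induction t using TensorProduct.induction_on with
  | zero => simp
  | add s t hs ht =>
    simp only [map_add] at hs ht ⊢
    rw [← hs, ← ht]
    abel
  | tmul y z =>
    simp only [LinearMap.add_apply, map_add, TensorProduct.map_tmul, LinearMap.id_apply,
      LinearMap.comp_apply, LinearMap.sub_apply, TensorProduct.sub_tmul, TensorProduct.tmul_sub,
      h4]
    abel

end GradedCommAlg

namespace SymmBimodule

variable {R M : Type*} [AddCommGroup R] [Module ℝ R] [AddCommGroup M] [Module ℝ M]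
  {A : GradedCommAlg R} (B : SymmBimodule A M)

/-! ### Signs and products in the semidirect product, by components -/

theorem semidirect_sign (d : ℤ) (x : R × M) :
    B.semidirect.sign d x = (A.sign d x.1, B.sign d x.2) := by
  have h : B.semidirect.sign d = (A.sign d).prodMap (B.sign d) := by
    refine B.semidirect.hom_ext fun a => ?_
    rw [B.semidirect.sign_apply, LinearMap.prodMap_apply, sign_mem A.toGrading d a.2.2.1,
      sign_mem B.toGrading d a.2.2.2]
    rfl
  exact LinearMap.congr_fun h x

/-- There is no term with both factors in `M`. For this reason the condition on the Taylor
coefficients in `M` will be linear. -/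
theorem semidirect_mul2 (x y : R × M) :
    B.semidirect.mul2 (x ⊗ₜ y) =
      (A.mul2 (x.1 ⊗ₜ y.1), B.lmul2 (x.1 ⊗ₜ y.2) + B.rmul2 (x.2 ⊗ₜ y.1)) := by
  simp only [GradedCommAlg.mul2, lmul2, rmul2, TensorProduct.lift.tmul, LinearMap.comp_apply,
    semidirect_sign]
  simp [semidirect, add_comm]

theorem sign_zero (v : R) : A.sign 0 v = v := by
  have h : A.sign 0 = LinearMap.id := by
    refine A.hom_ext fun a => ?_
    rw [A.sign_apply, zero_mul, zpow_zero, one_smul, LinearMap.id_apply]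
  rw [h, LinearMap.id_apply]

/-! ### The coboundary on the tensors with a given number of factors -/

theorem isHomog_of_word {d : ℤ} {f : A.CInf →ₗ[ℝ] M}
    (h : ∀ w, f (A.cls (A.word w)) ∈ B.gr (wdeg A.deg w + d + 1)) : B.IsHomog d f := by
  intro i x hx
  induction hx using Submodule.span_induction with
  | mem x hx => obtain ⟨w, rfl, rfl⟩ := hx; exact h w
  | zero => rw [map_zero]; exact Submodule.zero_mem _
  | add x y _ _ hx hy => rw [map_add]; exact Submodule.add_mem _ hx hy
  | smul c x _ hx => rw [map_smul]; exact Submodule.smul_mem _ c hx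

theorem Cochain.apply_word {n : ℕ} {d : ℤ} (f : B.Cochain n d) (w : List A.Letter)
    (hw : w.length ≠ n) : f.1 (A.cls (A.word w)) = 0 :=
  f.2.1 _ hw _ (Submodule.subset_span ⟨w, rfl, rfl⟩)

variable {B}

theorem Cochain.hom_ext {n : ℕ} {d e : ℤ} {f : B.Cochain n d} {g : B.Cochain n e}
    (h : ∀ w : List A.Letter, w.length = n → f.1 (A.cls (A.word w)) = g.1 (A.cls (A.word w))) :
    f.1 = g.1 := by
  refine A.cInf_hom_ext fun w => ?_
  by_cases hw : w.length = n
  · exact h w hw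
  · rw [Cochain.apply_word B f w hw, Cochain.apply_word B g w hw]

/-- A one-letter word has no proper cut and no product of neighbours. This is the origin of the
condition `c_1 = 0` for trivial morphisms. -/
theorem coboundaryMap_singleton (d : ℤ) (f : A.CInf →ₗ[ℝ] M) (hf : B.IsHomog d f)
    (a : A.Letter) : B.coboundaryMap d f hf (A.cls (A.word [a])) = 0 := by
  rw [coboundaryMap_cls, coboundaryT_word, A.m_cls_word]
  simp [dSum, mSum, A.cls_word_nil]

/-- The coboundary on `n + 1` factors sees `f` only on `n` factors. Hence equations for one map on
all tensors and equations for a sequence of cochains are interchangeable. -/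
theorem coboundaryMap_congr {d : ℤ} {f g : A.CInf →ₗ[ℝ] M} (hf : B.IsHomog d f)
    (hg : B.IsHomog d g) {w : List A.Letter}
    (h : ∀ w' : List A.Letter, w'.length + 1 = w.length →
      f (A.cls (A.word w')) = g (A.cls (A.word w'))) :
    B.coboundaryMap d f hf (A.cls (A.word w)) = B.coboundaryMap d g hg (A.cls (A.word w)) := by
  rcases w with _ | ⟨a, l⟩
  · rw [A.cls_word_nil, map_zero, map_zero]
  rcases List.eq_nil_or_concat l with rfl | ⟨l, b, rfl⟩
  · rw [coboundaryMap_singleton, coboundaryMap_singleton]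
  · simp only [List.concat_eq_append] at h ⊢
    rw [coboundaryMap_word, coboundaryMap_word, h _ (by simp), h (a :: l) (by simp),
      mSum_congr _ _ _ fun w' hw' => h w' (length_merges _ w' hw')]

/-! ### Morphisms to the semidirect product -/

variable {F : A.CInf →ₗ[ℝ] B.semidirect.CInf} {c : ∀ n, B.Cochain n 0}

/-- The component of the projection of `F` in `M[1]`. -/
noncomputable def taylor (F : A.CInf →ₗ[ℝ] B.semidirect.CInf) : A.CInf →ₗ[ℝ] M :=
  LinearMap.snd ℝ R M ∘ₗ B.semidirect.pr ∘ₗ F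

theorem HasTaylor.pr_word (hc : B.HasTaylor F c) (w : List A.Letter) :
    B.semidirect.pr (F (A.cls (A.word w))) =
      (A.pr (A.cls (A.word w)), (c w.length).1 (A.cls (A.word w))) := by
  have hm : A.cls (A.word w) ∈ A.lenPart w.length := Submodule.subset_span ⟨w, rfl, rfl⟩
  -- `HasTaylor` says nothing about the empty word, whose class is zero.
  rcases Nat.lt_trichotomy w.length 1 with h | h | h
  · obtain rfl : w = [] := List.length_eq_zero_iff.1 (by omega)
    simp only [A.cls_word_nil, map_zero]
    rfl
  · rw [h] at hm ⊢
    rw [hc.1 _ hm]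
    simp
  · rw [hc.2 _ h _ hm, A.pr_cls_word_eq_zero w (by omega)]
    rfl

theorem HasTaylor.taylor_word (hc : B.HasTaylor F c) (w : List A.Letter) :
    taylor F (A.cls (A.word w)) = (c w.length).1 (A.cls (A.word w)) :=
  congrArg Prod.snd (hc.pr_word w)

theorem HasTaylor.pr_eq (hc : B.HasTaylor F c) (x : A.CInf) :
    B.semidirect.pr (F x) = (A.pr x, taylor F x) := by
  have h : B.semidirect.pr ∘ₗ F = A.pr.prod (taylor F) := by
    refine A.cInf_hom_ext fun w => ?_
    rw [LinearMap.comp_apply, hc.pr_word, ← hc.taylor_word]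
    rfl
  exact LinearMap.congr_fun h x

theorem HasTaylor.isHomog (hc : B.HasTaylor F c) : B.IsHomog 0 (taylor F) :=
  B.isHomog_of_word fun w => by
    rw [hc.taylor_word]
    exact (c w.length).2.2 _ _ (cls_word_mem w)

/-- Insert `pr F = ι + c` into `pr_m_hom`. The component in `R` is the projection of `m_R`. The
component in `M` consists of `ι ⊗ c` and `c ⊗ ι`, that is, of `∂c + c ∘ m_R`, because `c` has degree
zero and introduces no sign. -/
theorem HasTaylor.pr_m (hF : IsLieCoalgHom A.toGrading B.semidirect.toGrading F)
    (hc : B.HasTaylor F c) (w : List A.Letter) :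
    B.semidirect.pr (B.semidirect.m (F (A.cls (A.word w)))) =
      B.semidirect.pr (F (A.m (A.cls (A.word w)))) +
        (0, B.coboundaryMap 0 (taylor F) hc.isHomog (A.cls (A.word w))) := by
  rw [GradedCommAlg.pr_m_hom hF]
  simp only [hc.pr_eq, semidirect_mul2]
  rw [coboundaryMap_cls, coboundaryT_word, A.pr_m_cls_word]
  have e : ∀ (p : List A.Letter → List A.Letter → R) (q : List A.Letter → List A.Letter → M),
      dSum w (fun u v => (p u v, q u v)) = (dSum w p, dSum w q) := fun p q =>
    Prod.ext (dSum_map (LinearMap.fst ℝ R M) w _) (dSum_map (LinearMap.snd ℝ R M) w _)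
  rw [e]
  simp [sign_zero]

/-- `F` commutes with the codifferentials if and only if the coboundary of the sum of its Taylor
coefficients in `M` is zero. -/
theorem HasTaylor.comm_iff (hF : IsLieCoalgHom A.toGrading B.semidirect.toGrading F)
    (hc : B.HasTaylor F c) :
    B.semidirect.m ∘ₗ F = F ∘ₗ A.m ↔ B.coboundaryMap 0 (taylor F) hc.isHomog = 0 := by
  rw [GradedCommAlg.hom_comm_iff hF]
  constructor
  · intro h
    refine A.cInf_hom_ext fun w => ?_
    have h1 := hc.pr_m hF w
    have h2 := LinearMap.congr_fun h (A.cls (A.word w))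
    simp only [LinearMap.comp_apply] at h2
    rw [h2, left_eq_add] at h1
    exact congrArg Prod.snd h1
  · intro h
    refine A.cInf_hom_ext fun w => ?_
    have h1 := hc.pr_m hF w
    rw [h] at h1
    exact h1.trans (add_zero _)

theorem HasTaylor.coboundaryMap_word (hc : B.HasTaylor F c) (n : ℕ) (w : List A.Letter)
    (hw : w.length = n + 1) :
    B.coboundaryMap 0 (taylor F) hc.isHomog (A.cls (A.word w)) =
      (B.coboundary (c n)).1 (A.cls (A.word w)) :=
  coboundaryMap_congr _ (c n).2.2 fun w' hw' => by
    obtain rfl : w'.length = n := by omega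
    exact hc.taylor_word w'

theorem HasTaylor.comm_iff_coboundary
    (hF : IsLieCoalgHom A.toGrading B.semidirect.toGrading F) (hc : B.HasTaylor F c) :
    B.semidirect.m ∘ₗ F = F ∘ₗ A.m ↔ ∀ j, 1 ≤ j → B.coboundary (c j) = 0 := by
  rw [hc.comm_iff hF]
  constructor
  · intro h j _
    refine Subtype.ext (Cochain.hom_ext fun w hw => ?_)
    rw [← hc.coboundaryMap_word j w hw, h]
    rfl
  · intro h
    refine A.cInf_hom_ext fun w => ?_
    -- Up to one letter the coboundary vanishes by itself. A word with `k + 2` letters tests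
    -- `∂c_{k+1}`, so the cochain `c 0` never enters.
    match w with
    | [] => rw [A.cls_word_nil, map_zero, map_zero]
    | [a] => exact coboundaryMap_singleton _ _ _ a
    | a :: b :: w =>
      rw [hc.coboundaryMap_word (w.length + 1) _ rfl, h _ (by omega)]
      rfl

/-! ### Trivial morphisms -/

/-- `F` is trivial if and only if the sum of its Taylor coefficients in `M` is a coboundary. -/
theorem HasTaylor.isTrivial_iff (hc : B.HasTaylor F c) :
    B.IsTrivial F ↔ ∃ (b : A.CInf →ₗ[ℝ] M) (hb : B.IsHomog (-1) b),
      taylor F = B.coboundaryMap (-1) b hb := by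
  -- In degree `-1` the last term of the coboundary has the sign `-(-1)^{-1} = 1`, so the right-hand
  -- side of the definition is `ι` plus the coboundary of `b`.
  have key : ∀ (b : A.CInf →ₗ[ℝ] M) (x : Tens R), LinearMap.inl ℝ R M (prT x) +
      (B.semidirect.mul2
        (TensorProduct.map (LinearMap.inl ℝ R M ∘ₗ A.sign (-1) ∘ₗ prT)
            (LinearMap.inr ℝ R M ∘ₗ b ∘ₗ A.cls) (decon x) +
          TensorProduct.map (LinearMap.inr ℝ R M ∘ₗ b ∘ₗ A.cls)
            (LinearMap.inl ℝ R M ∘ₗ prT) (decon x)) +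
      LinearMap.inr ℝ R M (b (A.m (A.cls x)))) = (A.pr (A.cls x), B.coboundaryT (-1) b x) := by
    intro b x
    have e1 : B.semidirect.mul2 ∘ₗ
        TensorProduct.map (LinearMap.inl ℝ R M) (LinearMap.inr ℝ R M) =
        LinearMap.inr ℝ R M ∘ₗ B.lmul2 :=
      TensorProduct.ext' fun r v => by simp [semidirect_mul2]
    have e2 : B.semidirect.mul2 ∘ₗ
        TensorProduct.map (LinearMap.inr ℝ R M) (LinearMap.inl ℝ R M) =
        LinearMap.inr ℝ R M ∘ₗ B.rmul2 :=
      TensorProduct.ext' fun v r => by simp [semidirect_mul2]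
    have e1' := LinearMap.congr_fun e1
    have e2' := LinearMap.congr_fun e2
    simp only [LinearMap.comp_apply] at e1' e2'
    rw [TensorProduct.map_comp (LinearMap.inl ℝ R M) (LinearMap.inr ℝ R M),
      TensorProduct.map_comp (LinearMap.inr ℝ R M) (LinearMap.inl ℝ R M), LinearMap.comp_apply,
      LinearMap.comp_apply, map_add, e1', e2']
    have e3 : A.m (A.cls x) = A.cls (A.mT x) := rfl
    have e4 : A.pr (A.cls x) = prT x := rfl
    rw [e3, e4, coboundaryT]
    simp
  constructor
  · rintro ⟨b, hb, h⟩
    refine ⟨b, hb, Submodule.linearMap_qext _ (LinearMap.ext fun x => ?_)⟩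
    have h1 := h x
    rw [key, hc.pr_eq] at h1
    exact congrArg Prod.snd h1
  · rintro ⟨b, hb, h⟩
    refine ⟨b, hb, fun x => ?_⟩
    rw [key, hc.pr_eq, h]
    rfl

/-- The equation `c = ∂b` is read off on each number of factors: one factor gives `c_1 = 0`, and `n
+ 1` factors give `c_{n+1} = ∂b_n`. -/
theorem HasTaylor.isTrivial_iff_coboundary (hc : B.HasTaylor F c) :
    B.IsTrivial F ↔ c 1 = 0 ∧ ∃ b : ∀ n, B.Cochain n (-1),
      ∀ n, 1 ≤ n → (c (n + 1) : A.CInf →ₗ[ℝ] M) = B.coboundary (b n) := by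
  rw [hc.isTrivial_iff]
  constructor
  · rintro ⟨b, hb, h⟩
    have hz : ∀ (n k : ℕ) (x : A.CInf), k ≠ n →
        (if k = n then b else 0 : A.CInf →ₗ[ℝ] M) x = 0 := fun n k x hk => by simp [hk]
    -- The restriction of `b` to `n` factors, extended by zero.
    let b' : ∀ n, B.Cochain n (-1) := fun n => ⟨A.glue fun k => if k = n then b else 0, by
      constructor
      · intro k hk x hx
        induction hx using Submodule.span_induction with
        | mem x hx =>
          obtain ⟨w, rfl, rfl⟩ := hx
          rw [A.glue_cls_word, hz n _ _ hk]
        | zero => exact map_zero _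
        | add x y _ _ hx hy => rw [map_add, hx, hy, add_zero]
        | smul r x _ hx => rw [map_smul, hx, smul_zero]
      · refine B.isHomog_of_word fun w => ?_
        rw [A.glue_cls_word]
        by_cases hw : w.length = n
        · rw [if_pos hw]; exact hb _ _ (cls_word_mem w)
        · rw [if_neg hw]; exact Submodule.zero_mem _⟩
    refine ⟨Subtype.ext (Cochain.hom_ext fun w hw => ?_), b', fun n _ =>
      Cochain.hom_ext fun w hw => ?_⟩
    · have ht := hc.taylor_word w
      obtain ⟨a, rfl⟩ := List.length_eq_one_iff.1 hw
      rw [h, coboundaryMap_singleton] at ht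
      exact ht.symm
    · have ht := hc.taylor_word w
      rw [hw, h] at ht
      rw [← ht]
      refine coboundaryMap_congr hb (b' n).2.2 fun w' hw' => ?_
      have hw'' : w'.length = n := by omega
      change _ = A.glue (fun k => if k = n then b else 0) _
      rw [A.glue_cls_word, if_pos hw'']
  · rintro ⟨h1, b, h⟩
    -- Conversely the `b n` are the components of a single map of degree `-1`; `b 0` plays no role,
    -- as the empty word has class zero.
    have hb : B.IsHomog (-1) (A.glue fun n => (b n).1) := B.isHomog_of_word fun w => by
      rw [A.glue_cls_word]
      exact (b w.length).2.2 _ _ (cls_word_mem w)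
    refine ⟨A.glue fun n => (b n).1, hb, A.cInf_hom_ext fun w => ?_⟩
    match w with
    | [] => rw [A.cls_word_nil, map_zero, map_zero]
    | [a] =>
      rw [coboundaryMap_singleton, hc.taylor_word, List.length_singleton, h1]
      rfl
    | a :: a' :: w =>
      have ht := hc.taylor_word (a :: a' :: w)
      have hh := h (w.length + 1) (by omega)
      rw [List.length_cons, List.length_cons, hh] at ht
      rw [ht]
      refine coboundaryMap_congr (b (w.length + 1)).2.2 hb fun w' hw' => ?_
      have hw'' : w'.length = w.length + 1 := by simpa using hw'
      rw [A.glue_cls_word, hw'']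

end SymmBimodule

end Harrison

/-! ### The proposition -/

theorem mainTheorem2 {R M : Type*} [AddCommGroup R] [Module ℝ R] [AddCommGroup M] [Module ℝ M]
    (A : Harrison.GradedCommAlg R) (B : Harrison.SymmBimodule A M) :
    -- the Harrison chains of `M` are a subcomplex of `C_∞(R ⋉ M)`
    (B.semidirect.m ∘ₗ B.semidirect.m = 0 ∧
      (∀ n, ∀ x ∈ B.semidirect.lenPart (n + 1), B.semidirect.m x ∈ B.semidirect.lenPart n) ∧
      B.boundary ∘ₗ B.boundary = 0 ∧
      (∀ n, ∀ x ∈ B.chainPart (n + 1), B.boundary x ∈ B.chainPart n) ∧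
      Function.Injective B.incl ∧
      (∀ n, ∀ x ∈ B.chainPart n, B.incl x ∈ B.semidirect.lenPart n) ∧
      B.semidirect.m ∘ₗ B.incl = B.incl ∘ₗ B.boundary) ∧
    ∀ (F : A.CInf →ₗ[ℝ] B.semidirect.CInf) (c : ∀ n, B.Cochain n 0),
      Harrison.IsLieCoalgHom A.toGrading B.semidirect.toGrading F → B.HasTaylor F c →
      -- `F` is a morphism of `C_∞` algebras iff all `c_j` are cocycles
      (B.semidirect.m ∘ₗ F = F ∘ₗ A.m ↔ ∀ j, 1 ≤ j → B.coboundary (c j) = 0) ∧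
      -- `F` is trivial iff `c_1 = 0` and `c_n = ∂ b_{n-1}` for `n > 1`
      (B.IsTrivial F ↔ c 1 = 0 ∧ ∃ b : ∀ n, B.Cochain n (-1),
        ∀ n, 1 ≤ n → (c (n + 1) : A.CInf →ₗ[ℝ] M) = B.coboundary (b n)) := by
  refine ⟨⟨B.semidirect.m_comp_m, B.semidirect.m_mem_lenPart, B.boundary_comp_boundary,
    B.boundary_mem_chainPart, B.incl_injective, B.incl_mem_lenPart, B.m_comp_incl⟩, ?_⟩
  intro F c hF hc
  exact ⟨hc.comm_iff_coboundary hF, hc.isTrivial_iff_coboundary⟩
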